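/- A $3$-graph $G$ (a $3$-uniform hypergraph) consists of a finite vertex set $V(G)$ and a set $E(G)$ of $3$-element subsets of $V(G)$; it is $F$-free if it has no (not necessarily induced) subgraph isomorphic to $F$. Its Lagrangian is $$\lambda(G)=\max\Big\{\sum_{e\in E(G)}\prod_{i\in e}x_i \;:\; x_i\ge 0 \text{ for } i\in V(G),\ \sum_{i\in V(G)}x_i=1\Big\},$$ with $\lambda(G)=0$ if $V(G)=\emptyset$, and the Lagrangian density of a $3$-graph $F$ is $\pi_\lambda(F)=\sup\{3!\,\lambda(G): G \text{ is an } F\text{-free } 3\text{-graph}\}$. A $3$-graph $F$ on $m$ vertices is called perfect if $\pi_\lambda(F)=3!\,\lambda(K_{m-1}^3)$, where $K_n^3$ is the complete $3$-graph on $n$ vertices. For $t\ge 1$ let $P_t$ be the $3$-uniform linear path of length $t$: it has $2t+1$ vertices $v_0,\dots,v_{2t}$ and the $t$ edges $\{v_{2i},v_{2i+1},v_{2i+2}\}$, $0\le i<t$. **Theorem 3.1.** Let $t=3$ or $t=4$. Then $$\pi_\lambda(P_t)=3!\,\lambda(K_{2t}^3),$$ so that $P_3$ and $P_4$ are perfect.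 Furthermore, there exists $\varepsilon=\varepsilon(t)>0$, depending only on $t$, such that every $3$-graph $G$ that is both $P_t$-free and $K_{2t}^3$-free satisfies $\lambda(G)\le\lambda(K_{2t}^3)-\varepsilon$. -/

import Mathlib

open scoped Nat

noncomputable section

/-- An `r`-uniform hypergraph (`r`-graph) with vertex set `V`: a finite set of edges, each of them
a set of exactly `r` vertices. -/
structure UniformHypergraph (V : Type*) (r : ℕ) where
  edges : Finset (Finset V)
  uniform : ∀ e ∈ edges, e.card = r

namespace UniformHypergraph

variable {V W : Type*} {r : ℕ}

/-- The complete `r`-graph on the vertex set `V`; on `n` vertices this is `K_n^r`. -/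
def complete (V : Type*) [Fintype V] (r : ℕ) : UniformHypergraph V r where
  edges := Finset.powersetCard r Finset.univ
  uniform := fun _ he => (Finset.mem_powersetCard.1 he).2

/-- `G` contains a copy of `F` as a (not necessarily induced) subgraph. -/
def Contains (G : UniformHypergraph V r) (F : UniformHypergraph W r) : Prop :=
  ∃ f : W ↪ V, ∀ e ∈ F.edges, e.map f ∈ G.edges

/-- `G` is `F`-free. -/
def Free (G : UniformHypergraph V r) (F : UniformHypergraph W r) : Prop :=
  ¬ G.Contains F

/-- The Lagrange polynomial `λ(G, x) = ∑_{e ∈ G} ∏_{i ∈ e} x_i`. -/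
def weight (G : UniformHypergraph V r) (x : V → ℝ) : ℝ :=
  ∑ e ∈ G.edges, ∏ i ∈ e, x i

/-- The Lagrangian `λ(G)`, the largest value of `λ(G, x)` over all `x` with nonnegative
coordinates summing to `1`. The maximum exists whenever `V` is nonempty, see
`exists_weight_eq_lagrangian`; the value is `0` if `V` is empty. -/
def lagrangian [Fintype V] (G : UniformHypergraph V r) : ℝ :=
  sSup (G.weight '' stdSimplex ℝ V)

/-- The Lagrangian density `π_λ(F) = sup {r! λ(G) : G is an F-free r-graph}`, the supremum being
over all finite `r`-graphs `G`. The set is bounded above, see `bddAbove_lagrangianDensity`. -/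
def lagrangianDensity (F : UniformHypergraph W r) : ℝ :=
  sSup {a : ℝ | ∃ (V : Type) (_ : Fintype V) (G : UniformHypergraph V r),
    G.Free F ∧ a = (r ! : ℝ) * G.lagrangian}

/-- An `r`-graph `F` on `m` vertices is perfect if `π_λ(F) = r! λ(K_{m-1}^r)`. -/
def IsPerfect [Fintype W] (F : UniformHypergraph W r) : Prop :=
  F.lagrangianDensity = (r ! : ℝ) * (complete (Fin (Fintype.card W - 1)) r).lagrangian

/-- The edge `{2i, 2i+1, 2i+2}` of the linear path of length `t`. -/
def linearPathEdge (t : ℕ) (i : Fin t) : Finset (Fin (2 * t + 1)) :=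
  {⟨2 * i, by omega⟩, ⟨2 * i + 1, by omega⟩, ⟨2 * i + 2, by omega⟩}

/-- The `3`-uniform linear path `P_t` of length `t`, on the vertices `0, …, 2t`: consecutive edges
meet in exactly one vertex and all other pairs of edges are disjoint. -/
def linearPath (t : ℕ) : UniformHypergraph (Fin (2 * t + 1)) 3 where
  edges := Finset.univ.image (linearPathEdge t)
  uniform := by
    intro e he
    obtain ⟨i, -, rfl⟩ := Finset.mem_image.1 he
    simp [linearPathEdge, Finset.card_insert_of_notMem]

/-- The maximum in the definition of the Lagrangian is attained. -/
theorem exists_weight_eq_lagrangian [Fintype V] [Nonempty V] (G : UniformHypergraph V r) :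
    ∃ x ∈ stdSimplex ℝ V, G.weight x = G.lagrangian ∧
      ∀ y ∈ stdSimplex ℝ V, G.weight y ≤ G.weight x := by
  classical
  have hne : (stdSimplex ℝ V).Nonempty :=
    ⟨_, single_mem_stdSimplex ℝ (Classical.arbitrary V)⟩
  have hc : ContinuousOn G.weight (stdSimplex ℝ V) := by
    unfold weight
    fun_prop
  obtain ⟨x, hx, h, hmax⟩ := (isCompact_stdSimplex ℝ V).exists_sSup_image_eq_and_ge hne hc
  exact ⟨x, hx, h.symm, hmax⟩

theorem lagrangian_le_exp_one [Fintype V] (G : UniformHypergraph V r) :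
    G.lagrangian ≤ Real.exp 1 := by
  classical
  refine Real.sSup_le ?_ (Real.exp_pos 1).le
  rintro _ ⟨x, hx, rfl⟩
  calc G.weight x ≤ ∑ e ∈ (Finset.univ : Finset V).powerset, ∏ i ∈ e, x i :=
        Finset.sum_le_sum_of_subset_of_nonneg (fun e _ => by simp)
          (fun e _ _ => Finset.prod_nonneg fun i _ => hx.1 i)
    _ = ∏ i, (1 + x i) := (Finset.prod_one_add _).symm
    _ ≤ ∏ i, Real.exp (x i) := Finset.prod_le_prod (fun i _ => by linarith [hx.1 i])
          (fun i _ => by linarith [Real.add_one_le_exp (x i)])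
    _ = Real.exp 1 := by rw [← Real.exp_sum, hx.2]

theorem bddAbove_lagrangianDensity (F : UniformHypergraph W r) :
    BddAbove {a : ℝ | ∃ (V : Type) (_ : Fintype V) (G : UniformHypergraph V r),
      G.Free F ∧ a = (r ! : ℝ) * G.lagrangian} := by
  refine ⟨(r ! : ℝ) * Real.exp 1, ?_⟩
  rintro _ ⟨V, _, G, -, rfl⟩
  exact mul_le_mul_of_nonneg_left G.lagrangian_le_exp_one (by positivity)

end UniformHypergraph

end

/-!
Fix an optimal weighting `x` of a `P_t`-free `3`-graph `G` whose support `S` is as small as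
possible. Moving weight between two vertices changes the Lagrange polynomial by a quadratic
polynomial (`weight_shift`). Hence the link of every vertex of `S` has weight at least `3 λ(G)`
(`le_link`), and any two vertices of `S` lie in a common edge within `S`, since otherwise one of
them could be removed from the support (`exists_optimal_covering`).

If `S` has at most `2t` vertices, then `6 λ(G)` is at most the value of `6 e₃` at the uniform
weighting on `2t` points; this follows from the tangent line of `2 y ^ 3 - 3 y ^ 2` at `1 / (2t)`.
When `G` is also `K_{2t}^3`-free, some triple is missing or `S` is smaller, and the bound is missed
by a fixed amount (`weight_le_sub_of_card_support_le`).

If `S` has more than `2t` vertices, then `λ(G)` is at most a smaller constant, `1 / 12` for `t = 3`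
and `8 / 75` for `t = 4`. Otherwise a weighted form of Mantel's theorem (`weighted_mantel`) gives a
triangle in the link of each vertex. For `t = 4` every vertex has weight at most `1 / 5`, because
its link has weight at most `(1 - x u) ^ 2 / 2`, and then each link has a triangle that avoids any
prescribed vertex. These triangles and the covering of pairs force a copy of `P_t`
(`not_pathFree_three`, `not_pathFree_four`): take a path with `t - 1` edges and two points off it.
As the path cannot be extended, no edge lies entirely off the path, and an edge with just one vertex
on the path does not meet it in one of the four free vertices of its two end edges. This leaves few
positions for the edge that covers the two points, and comparing the links of the two points then
exhibits a longer path in each of them.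

In this last part the vertices of a configuration are numbered by an embedding `f : Fin n ↪ U`, and
statements about edges are pulled back along `f`, so that it is decidable whether a list of sets is
a linear path. The path is always numbered `{0, 1, 2}, {2, 3, 4}, …`.
-/

/-! ### Linear paths in sets of triples -/

namespace LinearPath

variable {U : Type*} [DecidableEq U] {n : ℕ}

/-- A list of sets is a linear path if consecutive sets meet in exactly one point and all other
pairs are disjoint. -/
def IsLinearPath : List (Finset U) → Prop
  | [] => True
  | [_] => True
  | e :: e' :: l => (e ∩ e').card = 1 ∧ (∀ s ∈ l, Disjoint e s) ∧ IsLinearPath (e' :: l)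

instance decidableIsLinearPath : ∀ l : List (Finset U), Decidable (IsLinearPath l)
  | [] => isTrue trivial
  | [_] => isTrue trivial
  | e :: e' :: l =>
    have := decidableIsLinearPath (e' :: l)
    inferInstanceAs (Decidable ((e ∩ e').card = 1 ∧ (∀ s ∈ l, Disjoint e s) ∧
      IsLinearPath (e' :: l)))

/-- The vertices of a linear path of triples can be enumerated along the path, starting at any
vertex of the first triple that lies in no other triple. -/
theorem IsLinearPath.exists_enum (l : List (Finset U)) : ∀ e : Finset U,
    IsLinearPath (e :: l) → (∀ s ∈ e :: l, s.card = 3) → ∀ v ∈ e, (∀ s ∈ l, v ∉ s) →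
    ∃ g : ℕ → U, g 0 = v ∧ Set.InjOn g (Set.Iic (2 * (l.length + 1))) ∧
      (∀ i < l.length + 1, {g (2 * i), g (2 * i + 1), g (2 * i + 2)} ∈ e :: l) ∧
      ∀ m ≤ 2 * (l.length + 1), ∃ s ∈ e :: l, g m ∈ s := by
  induction l with
  | nil =>
    intro e _ hc v hv _
    obtain ⟨y, z, hyz, hE⟩ := Finset.card_eq_two.1
      (show (e.erase v).card = 2 by rw [Finset.card_erase_of_mem hv, hc e (by simp)])
    have he : e = {v, y, z} := by rw [← Finset.insert_erase hv, hE]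
    have hvy : v ≠ y := fun h => Finset.notMem_erase v e (by rw [hE, h]; simp)
    have hvz : v ≠ z := fun h => Finset.notMem_erase v e (by rw [hE, h]; simp)
    refine ⟨fun m => if m = 0 then v else if m = 1 then y else z, by simp, ?_, ?_, ?_⟩
    · intro i hi j hj hij
      simp only [List.length_nil, Set.mem_Iic] at hi hj
      interval_cases i <;> interval_cases j <;> simp_all
    · intro i hi
      obtain rfl : i = 0 := by simpa using hi
      simp [he]
    · intro m hm
      refine ⟨e, by simp, ?_⟩
      rw [he]
      dsimp only
      split_ifs <;> simp
  | cons e' l ih =>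
    intro e hP hc v hv hvl
    obtain ⟨h1, h2, h3⟩ := hP
    obtain ⟨p, hp⟩ := Finset.card_eq_one.1 h1
    have hpe : p ∈ e ∧ p ∈ e' := Finset.mem_inter.1 (by rw [hp]; simp)
    have hvp : v ≠ p := fun h => hvl e' (by simp) (h ▸ hpe.2)
    obtain ⟨g, g0, ginj, gH, gm⟩ := ih e' h3 (fun s hs => hc s (List.mem_cons_of_mem _ hs)) p hpe.2
      (fun s hs hps => Finset.disjoint_left.1 (h2 s hs) hpe.1 hps)
    obtain ⟨y, hE⟩ := Finset.card_eq_one.1 (show ((e.erase v).erase p).card = 1 by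
      rw [Finset.card_erase_of_mem (Finset.mem_erase.2 ⟨hvp.symm, hpe.1⟩),
        Finset.card_erase_of_mem hv, hc e (by simp)])
    have hy : y ∈ (e.erase v).erase p := by rw [hE]; simp
    have hyp : y ≠ p := (Finset.mem_erase.1 hy).1
    have hyv : y ≠ v := (Finset.mem_erase.1 (Finset.mem_erase.1 hy).2).1
    have hye : y ∈ e := (Finset.mem_erase.1 (Finset.mem_erase.1 hy).2).2
    have he : e = {v, y, p} := by
      rw [← Finset.insert_erase hv, ← Finset.insert_erase (Finset.mem_erase.2 ⟨hvp.symm, hpe.1⟩),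
        hE, Finset.pair_comm]
    -- A vertex of `e` other than `p` is new.
    have hnew : ∀ u ∈ e, u ≠ p → ∀ m ≤ 2 * (l.length + 1), u ≠ g m := by
      rintro u hu hup m hm rfl
      obtain ⟨s, hs, hgs⟩ := gm m hm
      rcases List.mem_cons.1 hs with rfl | hs
      · have : g m ∈ e ∩ s := Finset.mem_inter.2 ⟨hu, hgs⟩
        rw [hp] at this
        exact hup (by simpa using this)
      · exact Finset.disjoint_left.1 (h2 s hs) hu hgs
    refine ⟨fun m => if m = 0 then v else if m = 1 then y else g (m - 2), by simp, ?_, ?_, ?_⟩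
    · intro i hi j hj hij
      simp only [List.length_cons, Set.mem_Iic] at hi hj
      dsimp only at hij
      split_ifs at hij with a1 a2 a3 a4 a5 a6 a7 a8
      · omega
      · exact absurd hij.symm hyv
      · exact absurd hij (hnew v hv hvp _ (by omega))
      · exact absurd hij hyv
      · omega
      · exact absurd hij (hnew y hye hyp _ (by omega))
      · exact absurd hij.symm (hnew v hv hvp _ (by omega))
      · exact absurd hij.symm (hnew y hye hyp _ (by omega))
      · have := ginj (show i - 2 ≤ _ by omega) (show j - 2 ≤ _ by omega) hij
        omega
    · intro i hi
      rcases Nat.eq_zero_or_pos i with rfl | hi0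
      · simp [g0, ← he]
      · have := gH (i - 1) (by simp only [List.length_cons] at hi; omega)
        refine List.mem_cons_of_mem _ ?_
        have e1 : 2 * (i - 1) = 2 * i - 2 := by omega
        have e2 : 2 * (i - 1) + 1 = 2 * i + 1 - 2 := by omega
        have e3 : 2 * (i - 1) + 2 = 2 * i + 2 - 2 := by omega
        rw [e2, e3, e1] at this
        dsimp only
        rw [if_neg (by omega), if_neg (by omega), if_neg (by omega), if_neg (by omega),
          if_neg (by omega), if_neg (by omega)]
        exact this
    · intro m hm
      simp only [List.length_cons] at hm
      dsimp only
      split_ifs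
      · exact ⟨e, by simp, hv⟩
      · exact ⟨e, by simp, hye⟩
      · obtain ⟨s, hs, h⟩ := gm (m - 2) (by omega)
        exact ⟨s, List.mem_cons_of_mem _ hs, h⟩

/-- There is no linear path of `t` edges, the edges being the sets that satisfy `H`. Such a path is
a list of sets, without an enumeration of its vertices. -/
def PathFree (H : Finset U → Prop) (t : ℕ) : Prop :=
  ∀ l : List (Finset U), l.length = t → (∀ s ∈ l, H s) → ¬ IsLinearPath l

/-- A linear path of `t ≥ 1` triples yields a vertex enumeration as in `linearPath t`. -/
theorem exists_embedding_of_not_pathFree {H : Finset U → Prop} (hH : ∀ e, H e → e.card = 3)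
    {t : ℕ} (ht : 0 < t) (h : ¬ PathFree H t) :
    ∃ f : Fin (2 * t + 1) ↪ U, ∀ i : Fin t,
      H ((UniformHypergraph.linearPathEdge t i).map f) := by
  simp only [PathFree, not_forall, not_not] at h
  obtain ⟨l, hl, hlH, hP⟩ := h
  cases l with
  | nil => simp at hl; omega
  | cons e l =>
    have hc : e.card = 3 := hH e (hlH e (by simp))
    -- The first triple has a vertex outside the second one, hence outside all others.
    have hv : ∃ v ∈ e, ∀ s ∈ l, v ∉ s := by
      cases l with
      | nil =>
        obtain ⟨v, hv⟩ := Finset.card_pos.1 (show 0 < e.card by omega)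
        exact ⟨v, hv, by simp⟩
      | cons e' l =>
        obtain ⟨h1, h2, -⟩ := hP
        obtain ⟨v, hv⟩ := Finset.card_pos.1 (show 0 < (e \ e').card by
          have := Finset.card_sdiff_add_card_inter e e'
          omega)
        obtain ⟨hve, hve'⟩ := Finset.mem_sdiff.1 hv
        refine ⟨v, hve, fun s hs => ?_⟩
        rcases List.mem_cons.1 hs with rfl | hs
        · exact hve'
        · exact Finset.disjoint_left.1 (h2 s hs) hve
    obtain ⟨v, hve, hvl⟩ := hv
    obtain ⟨g, -, ginj, gH, -⟩ := hP.exists_enum l e (fun s hs => hH s (hlH s hs)) v hve hvl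
    simp only [List.length_cons] at hl
    subst hl
    refine ⟨⟨fun i => g i, fun i j hij => Fin.ext (ginj ?_ ?_ hij)⟩, fun i => ?_⟩
    · have := i.2
      simp only [Set.mem_Iic]; omega
    · have := j.2
      simp only [Set.mem_Iic]; omega
    · have := hlH _ (gH i i.2)
      rw [UniformHypergraph.linearPathEdge, Finset.map_insert, Finset.map_insert,
        Finset.map_singleton]
      exact this

/-- The edge predicate `H` restricted to the points enumerated by `f`. -/
def pull (H : Finset U → Prop) (f : Fin n ↪ U) (s : Finset (Fin n)) : Prop :=
  H (s.map f)

theorem isLinearPath_map (f : Fin n ↪ U) : ∀ l : List (Finset (Fin n)),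
    IsLinearPath l → IsLinearPath (l.map (Finset.map f))
  | [], _ => trivial
  | [_], _ => trivial
  | e :: e' :: l, h => by
    refine ⟨?_, ?_, isLinearPath_map f (e' :: l) h.2.2⟩
    · rw [← Finset.map_inter, Finset.card_map]
      exact h.1
    · intro s hs
      obtain ⟨s', hs', rfl⟩ := List.mem_map.1 hs
      exact (Finset.disjoint_map f).2 (h.2.1 s' hs')

theorem PathFree.pull {H : Finset U → Prop} {t : ℕ} (h : PathFree H t) (f : Fin n ↪ U) :
    PathFree (pull H f) t := by
  intro l hl hs hP
  refine h (l.map (Finset.map f)) (by simpa using hl) ?_ (isLinearPath_map f l hP)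
  intro s hs'
  obtain ⟨s', h', rfl⟩ := List.mem_map.1 hs'
  exact hs s' h'

theorem PathFree.two {H : Finset U → Prop} (h : PathFree H 2) {a b : Finset U}
    (ha : H a) (hb : H b) (hP : IsLinearPath [a, b]) : False :=
  h [a, b] rfl (by simp [ha, hb]) hP

theorem PathFree.three {H : Finset U → Prop} (h : PathFree H 3) {a b c : Finset U}
    (ha : H a) (hb : H b) (hc : H c) (hP : IsLinearPath [a, b, c]) : False :=
  h [a, b, c] rfl (by simp [ha, hb, hc]) hP

theorem PathFree.four {H : Finset U → Prop} (h : PathFree H 4) {a b c d : Finset U}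
    (ha : H a) (hb : H b) (hc : H c) (hd : H d) (hP : IsLinearPath [a, b, c, d]) : False :=
  h [a, b, c, d] rfl (by simp [ha, hb, hc, hd]) hP

/-- The enumeration `f` continued by a new point `d`. -/
def snoc (f : Fin n ↪ U) (d : U) (hd : ∀ m, f m ≠ d) : Fin (n + 1) ↪ U where
  toFun := Fin.snoc (α := fun _ => U) f d
  inj' := by
    intro i j
    refine Fin.lastCases ?_ (fun i => ?_) i <;> refine Fin.lastCases ?_ (fun j => ?_) j
    · simp
    · intro h
      exact absurd (by simpa using h.symm) (hd j)
    · intro h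
      exact absurd (by simpa using h) (hd i)
    · simp

omit [DecidableEq U] in
@[simp] theorem snoc_castSucc (f : Fin n ↪ U) (d : U) (hd : ∀ m, f m ≠ d) (i : Fin n) :
    snoc f d hd i.castSucc = f i :=
  Fin.snoc_castSucc (α := fun _ => U) d f i

omit [DecidableEq U] in
@[simp] theorem snoc_last (f : Fin n ↪ U) (d : U) (hd : ∀ m, f m ≠ d) :
    snoc f d hd (Fin.last n) = d :=
  Fin.snoc_last (α := fun _ => U) d f

omit [DecidableEq U] in
theorem pull_snoc {H : Finset U → Prop} {f : Fin n ↪ U} {s : Finset (Fin n)} (h : pull H f s)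
    (d : U) (hd : ∀ m, f m ≠ d) : pull H (snoc f d hd) (s.map Fin.castSuccEmb) := by
  have : s.map f = (s.map Fin.castSuccEmb).map (snoc f d hd) := by
    rw [Finset.map_map]
    congr 1
    ext i
    simp
  rwa [pull, ← this]

omit [DecidableEq U] in
theorem pull_trans {m : ℕ} {H : Finset U → Prop} {f : Fin n ↪ U} {s : Finset (Fin m)}
    {t : Finset (Fin n)} (h : pull H f t) (σ : Fin m ↪ Fin n) (hst : s.map σ = t) :
    pull H (σ.trans f) s := by
  subst hst
  rwa [pull, ← Finset.map_map]

omit [DecidableEq U] in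
theorem pull_of_trans {m : ℕ} {H : Finset U → Prop} {f : Fin n ↪ U} {s : Finset (Fin m)}
    {t : Finset (Fin n)} {σ : Fin m ↪ Fin n} (h : pull H (σ.trans f) s) (hst : s.map σ = t) :
    pull H f t := by
  subst hst
  rwa [pull, ← Finset.map_map] at h

/-- `H` is a set of triples such that any two distinct points lie in a common triple. -/
structure CoversPairs (H : Finset U → Prop) : Prop where
  card_eq : ∀ e, H e → e.card = 3
  cover : ∀ i j, i ≠ j → ∃ k, H {i, j, k}

theorem CoversPairs.ne {H : Finset U → Prop} (hH : CoversPairs H) {i j k : U} (h : H {i, j, k}) :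
    i ≠ j ∧ i ≠ k ∧ j ≠ k := by
  have := hH.card_eq _ h
  refine ⟨?_, ?_, ?_⟩ <;> rintro rfl
  · simp only [Finset.insert_eq_of_mem, Finset.mem_insert, true_or] at this
    have := Finset.card_le_two (a := i) (b := k)
    omega
  · rw [Finset.pair_comm, Finset.insert_eq_of_mem (by simp)] at this
    have := Finset.card_le_two (a := i) (b := j)
    omega
  · simp only [Finset.insert_eq_of_mem, Finset.mem_singleton] at this
    have := Finset.card_le_two (a := i) (b := j)
    omega

/-- The third point of a triple through two of the enumerated points is either enumerated or
continues the enumeration. -/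
theorem CoversPairs.pull {H : Finset U → Prop} (hH : CoversPairs H) (f : Fin n ↪ U)
    (i j : Fin n) (hij : i ≠ j) :
    (∃ k, k ≠ i ∧ k ≠ j ∧ pull H f {i, j, k}) ∨
      ∃ d, ∃ hd : ∀ m, f m ≠ d, pull H (snoc f d hd) {i.castSucc, j.castSucc, Fin.last n} := by
  obtain ⟨k, hk⟩ := hH.cover (f i) (f j) (fun h => hij (f.injective h))
  by_cases hd : ∀ m, f m ≠ k
  · right
    exact ⟨k, hd, by simpa [LinearPath.pull, Finset.map_insert] using hk⟩
  · left
    push Not at hd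
    obtain ⟨m, rfl⟩ := hd
    have := hH.ne hk
    refine ⟨m, ?_, ?_, by simpa [LinearPath.pull, Finset.map_insert] using hk⟩
    · rintro rfl
      exact this.2.1 rfl
    · rintro rfl
      exact this.2.2 rfl

theorem exists_new_point [Fintype U] (f : Fin n ↪ U) (h : n < Fintype.card U) :
    ∃ d, ∀ m, f m ≠ d := by
  by_contra hcon
  push Not at hcon
  have := Fintype.card_le_of_surjective f hcon
  simp at this
  omega

omit [DecidableEq U] in
theorem pull_congr {H : Finset U → Prop} {f : Fin n ↪ U} {s t : Finset (Fin n)} (h : pull H f s)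
    (hst : t = s) : pull H f t :=
  hst ▸ h

theorem exists_increasing_triple {R : Fin n → Fin n → Prop} (hR : ∀ i j, R i j → R j i)
    {Q : Fin n → Prop} {i j k : Fin n} (hij : i ≠ j) (hik : i ≠ k) (hjk : j ≠ k)
    (hi : Q i) (hj : Q j) (hk : Q k) (rij : R i j) (rik : R i k) (rjk : R j k) :
    ∃ a b c, a < b ∧ b < c ∧ Q a ∧ Q b ∧ Q c ∧ R a b ∧ R a c ∧ R b c := by
  rcases lt_or_gt_of_ne hij with h1 | h1 <;> rcases lt_or_gt_of_ne hik with h2 | h2 <;>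
    rcases lt_or_gt_of_ne hjk with h3 | h3
  · exact ⟨i, j, k, h1, h3, hi, hj, hk, rij, rik, rjk⟩
  · exact ⟨i, k, j, h2, h3, hi, hk, hj, rik, rij, hR _ _ rjk⟩
  · exact absurd (h1.trans h3) h2.not_gt
  · exact ⟨k, i, j, h2, h1, hk, hi, hj, hR _ _ rik, hR _ _ rjk, rij⟩
  · exact ⟨j, i, k, h1, h2, hj, hi, hk, hR _ _ rij, rjk, rik⟩
  · exact absurd (h3.trans h1) h2.not_gt
  · exact ⟨j, k, i, h3, h2, hj, hk, hi, rjk, hR _ _ rij, hR _ _ rik⟩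
  · exact ⟨k, j, i, h3, h1, hk, hj, hi, hR _ _ rjk, hR _ _ rik, hR _ _ rij⟩

/-! ### Linear paths of length two -/

/-- Two points off a triple are joined to it by triples that cannot all meet it in two points. -/
theorem not_pathFree_two [Fintype U] {H : Finset U → Prop} (hH : CoversPairs H)
    (hU : 5 ≤ Fintype.card U) : ¬ PathFree H 2 := by
  intro hN
  obtain ⟨i, j, hij⟩ := Fintype.exists_pair_of_one_lt_card (show 1 < Fintype.card U by omega)
  obtain ⟨k, hk⟩ := hH.cover i j hij
  have hne := hH.ne hk
  let f₀ : Fin 3 ↪ U := ⟨![i, j, k], by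
    intro a b
    fin_cases a <;> fin_cases b <;> simp [hne, hne.1.symm, hne.2.1.symm, hne.2.2.symm]⟩
  have h₀ : pull H f₀ {0, 1, 2} := by
    rw [pull, Finset.map_insert, Finset.map_insert, Finset.map_singleton]
    exact hk
  obtain ⟨d, hd⟩ := exists_new_point f₀ (by omega)
  obtain ⟨d', hd'⟩ := exists_new_point (snoc f₀ d hd) (by omega)
  have h₂ := pull_snoc (pull_snoc h₀ d hd) d' hd'
  generalize snoc (snoc f₀ d hd) d' hd' = f at h₂
  replace h₂ : pull H f {0, 1, 2} := pull_congr h₂ (by decide)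
  have hF := hN.pull f
  rcases hH.pull f 0 3 (by decide) with ⟨a, a0, a3, ha⟩ | ⟨a, ha, hna⟩
  · rcases hH.pull f 1 4 (by decide) with ⟨b, b0, b3, hb⟩ | ⟨b, hb, hnb⟩
    · rcases hH.pull f 2 4 (by decide) with ⟨c, c0, c3, hc⟩ | ⟨c, hc, hnc⟩
      · fin_cases a <;> fin_cases b <;> fin_cases c <;> first
          | exact absurd rfl a0 | exact absurd rfl a3 | exact absurd rfl b0 | exact absurd rfl b3
          | exact absurd rfl c0 | exact absurd rfl c3
          | exact hF.two h₂ ha (by decide) | exact hF.two h₂ hb (by decide)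
          | exact hF.two h₂ hc (by decide) | exact hF.two ha hb (by decide)
          | exact hF.two ha hc (by decide)
      · exact (hN.pull _).two (pull_snoc h₂ c hc) hnc (by decide)
    · exact (hN.pull _).two (pull_snoc h₂ b hb) hnb (by decide)
  · exact (hN.pull _).two (pull_snoc h₂ a ha) hna (by decide)

/-! ### Linear paths of length three -/

variable {H : Finset U → Prop}

/-- If the path `{0,1,2}, {2,3,4}` cannot be extended and `{5,6,7}` is an edge off it, then the edge
through `0` and a point `x` of `{5,6,7}` has to be `{0,1,x}`. -/
theorem pull_zero_one_of_outer_three (hH : CoversPairs H) (hN : PathFree H 3) (f : Fin 8 ↪ U)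
    (hA : pull H f {0, 1, 2}) (hB : pull H f {2, 3, 4}) (hT : pull H f {5, 6, 7}) (x : Fin 8)
    (hx : x = 5 ∨ x = 6 ∨ x = 7) : pull H f {0, 1, x} := by
  have hF := hN.pull f
  rcases hH.pull f 0 x (by rcases hx with rfl | rfl | rfl <;> decide) with
    ⟨k, k0, kx, hk⟩ | ⟨d, hd, hk⟩
  · rcases hx with rfl | rfl | rfl <;> fin_cases k <;> first
      | exact absurd rfl k0
      | exact absurd rfl kx
      | exact pull_congr hk (by decide)
      | exact (hF.three hT hk hB (by decide)).elim
      | exact (hF.three hk hA hB (by decide)).elim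
  · exact ((hN.pull _).three hk (pull_snoc hA d hd) (pull_snoc hB d hd)
      (by rcases hx with rfl | rfl | rfl <;> decide)).elim

/-- A path of length two that cannot be extended has no edge off it: otherwise some edge through
`2` and a point of that edge would give a longer path. -/
theorem not_outer_three (hH : CoversPairs H) (hN : PathFree H 3) (f : Fin 8 ↪ U)
    (hA : pull H f {0, 1, 2}) (hB : pull H f {2, 3, 4}) : ¬ pull H f {5, 6, 7} := by
  intro hT
  have h0 := pull_zero_one_of_outer_three hH hN f hA hB hT
  have hF := hN.pull f
  have h3 : ∀ x : Fin 8, x = 5 ∨ x = 6 ∨ x = 7 → pull H f {3, 4, x} := by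
    intro x hx
    have := pull_zero_one_of_outer_three hH hN
      ((Equiv.swap 0 3 * Equiv.swap 1 4 : Equiv.Perm (Fin 8)).toEmbedding.trans f)
      (pull_trans hB _ (by decide)) (pull_trans hA _ (by decide)) (pull_trans hT _ (by decide)) x hx
    refine pull_of_trans this ?_
    rcases hx with rfl | rfl | rfl <;> decide
  rcases hH.pull f 2 5 (by decide) with ⟨k, k2, k5, hk⟩ | ⟨d, hd, hk⟩
  · fin_cases k <;> first
      | exact absurd rfl k2
      | exact absurd rfl k5
      | exact hF.three hT hk hA (by decide)
      | exact hF.three hT hk hB (by decide)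
      | exact hF.three hA hk (h3 6 (by simp)) (by decide)
      | exact hF.three hA hk (h3 7 (by simp)) (by decide)
  · exact (hN.pull _).three (pull_snoc hA d hd) hk (pull_snoc (h3 5 (by simp)) d hd) (by decide)

/-- If the path `{0,1,2}, {2,3,4}` cannot be extended and an edge leaves `5` and the path, then it
returns to the middle point `2`. -/
theorem eq_middle_of_outer_three (hH : CoversPairs H) (hN : PathFree H 3) (g : Fin 6 ↪ U)
    (hA : pull H g {0, 1, 2}) (hB : pull H g {2, 3, 4}) {i j : U} (hij : H {g 5, i, j})
    (hi : ∀ m, g m ≠ i) : j = g 2 := by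
  have hA' := pull_snoc hA i hi
  have hB' := pull_snoc hB i hi
  by_cases hj : ∃ m, g m = j
  · obtain ⟨m, rfl⟩ := hj
    have hm : pull H (snoc g i hi) {5, 6, m.castSucc} := by
      rw [pull, Finset.map_insert, Finset.map_insert, Finset.map_singleton, snoc_castSucc]
      have e5 : snoc g i hi 5 = g 5 := snoc_castSucc g i hi 5
      have e6 : snoc g i hi 6 = i := snoc_last g i hi
      rwa [e5, e6]
    have hF := hN.pull (snoc g i hi)
    have h5 := (hH.ne hij).2.1
    fin_cases m <;> first
      | rfl
      | exact absurd rfl h5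
      | exact (hF.three hm hA' hB' (by decide)).elim
      | exact (hF.three hm hB' hA' (by decide)).elim
  · push Not at hj
    have hj' : ∀ m, snoc g i hi m ≠ j := by
      intro m
      refine Fin.lastCases ?_ (fun m => ?_) m
      · rw [snoc_last]
        exact (hH.ne hij).2.2
      · rw [snoc_castSucc]
        exact hj m
    refine (not_outer_three hH hN (snoc (snoc g i hi) j hj')
      (pull_congr (pull_snoc hA' j hj') (by decide))
      (pull_congr (pull_snoc hB' j hj') (by decide)) ?_).elim
    rw [pull, Finset.map_insert, Finset.map_insert, Finset.map_singleton]
    have e5 : snoc (snoc g i hi) j hj' 5 = g 5 :=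
      (snoc_castSucc (snoc g i hi) j hj' 5).trans (snoc_castSucc g i hi 5)
    have e6 : snoc (snoc g i hi) j hj' 6 = i :=
      (snoc_castSucc (snoc g i hi) j hj' 6).trans (snoc_last g i hi)
    have e7 : snoc (snoc g i hi) j hj' 7 = j := snoc_last _ j hj'
    rwa [e5, e6, e7]

/-- Any triangle in the link of a point `5` off the path lies on the path. -/
theorem exists_link_triangle_three (hH : CoversPairs H) (hN : PathFree H 3)
    (htri : ∀ v, ∃ i j k, H {v, i, j} ∧ H {v, i, k} ∧ H {v, j, k}) (g : Fin 6 ↪ U)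
    (hA : pull H g {0, 1, 2}) (hB : pull H g {2, 3, 4}) :
    ∃ a b c : Fin 6, a < b ∧ b < c ∧ c < 5 ∧
      pull H g {a, b, 5} ∧ pull H g {a, c, 5} ∧ pull H g {b, c, 5} := by
  obtain ⟨i, j, k, hij, hik, hjk⟩ := htri (g 5)
  have hji : H {g 5, j, i} := by rwa [Finset.pair_comm]
  have hki : H {g 5, k, i} := by rwa [Finset.pair_comm]
  have hkj : H {g 5, k, j} := by rwa [Finset.pair_comm]
  have key : ∀ x y z, H {g 5, x, y} → H {g 5, x, z} → H {g 5, y, z} → ∃ m, g m = x := by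
    intro x y z hxy hxz hyz
    by_contra hx
    push Not at hx
    have h1 := eq_middle_of_outer_three hH hN g hA hB hxy hx
    have h2 := eq_middle_of_outer_three hH hN g hA hB hxz hx
    exact (hH.ne hyz).2.2 (h1.trans h2.symm)
  obtain ⟨a, rfl⟩ := key i j k hij hik hjk
  obtain ⟨b, rfl⟩ := key j _ k hji hjk hik
  obtain ⟨c, rfl⟩ := key k _ _ hki hkj hij
  have conv : ∀ x y : Fin 6, H {g 5, g x, g y} → pull H g {x, y, 5} := by
    intro x y h
    rw [pull, Finset.map_insert, Finset.map_insert, Finset.map_singleton]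
    rwa [Finset.insert_comm, Finset.pair_comm (g 5)] at h
  have lt : ∀ x : Fin 6, g 5 ≠ g x → x < 5 := by
    intro x hx
    rcases lt_or_eq_of_le (Fin.le_last x) with h | rfl
    · exact h
    · exact absurd rfl hx
  obtain ⟨a, b, c, h1, h2, -, -, h3, h4⟩ := exists_increasing_triple
    (R := fun x y => pull H g {x, y, 5}) (fun x y h => by rwa [Finset.insert_comm] at h)
    (Q := fun x => x < 5)
    (fun e => (hH.ne hij).2.2 (congrArg g e)) (fun e => (hH.ne hik).2.2 (congrArg g e))
    (fun e => (hH.ne hjk).2.2 (congrArg g e)) (lt _ (hH.ne hij).1) (lt _ (hH.ne hij).2.1)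
    (lt _ (hH.ne hjk).2.1) (conv _ _ hij) (conv _ _ hik) (conv _ _ hjk)
  exact ⟨a, b, c, h1, h2, h3, h4⟩

theorem increasing_triple_lt_five : ∀ a b c : Fin 7, a < b → b < c → c < 5 →
    (a = 0 ∧ b = 1) ∨ (b = 3 ∧ c = 4) ∨ (a = 0 ∧ b = 2 ∧ c = 3) ∨ (a = 0 ∧ b = 2 ∧ c = 4) ∨
      (a = 1 ∧ b = 2 ∧ c = 3) ∨ (a = 1 ∧ b = 2 ∧ c = 4) := by
  decide

/-- The link of `5` contains a triangle on `2`, one of `0, 1` and one of `3, 4`. -/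
theorem exists_link_triangle_through_middle (hH : CoversPairs H) (hN : PathFree H 3)
    (htri : ∀ v, ∃ i j k, H {v, i, j} ∧ H {v, i, k} ∧ H {v, j, k}) (f : Fin 7 ↪ U)
    (hA : pull H f {0, 1, 2}) (hB : pull H f {2, 3, 4}) (hD : pull H f {2, 5, 6}) :
    ∃ a c : Fin 7, (a = 0 ∨ a = 1) ∧ (c = 3 ∨ c = 4) ∧
      pull H f {a, 2, 5} ∧ pull H f {a, c, 5} ∧ pull H f {2, c, 5} := by
  have hF := hN.pull f
  have h01 : ¬ pull H f {0, 1, 5} := fun h => hF.three hB hD h (by decide)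
  have h34 : ¬ pull H f {3, 4, 5} := fun h => hF.three hA hD h (by decide)
  obtain ⟨a, b, c, hab, hbc, hc, rab, rac, rbc⟩ := exists_link_triangle_three hH hN htri
    (Fin.castSuccEmb.trans f) (pull_trans hA _ (by decide)) (pull_trans hB _ (by decide))
  have rab' : pull H f {a.castSucc, b.castSucc, 5} := pull_of_trans rab (by simp)
  have rac' : pull H f {a.castSucc, c.castSucc, 5} := pull_of_trans rac (by simp)
  have rbc' : pull H f {b.castSucc, c.castSucc, 5} := pull_of_trans rbc (by simp)
  rcases increasing_triple_lt_five a.castSucc b.castSucc c.castSucc hab hbc hc with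
    ⟨ha, hb⟩ | ⟨ha, hb⟩ | ⟨ha, hb, hc⟩ | ⟨ha, hb, hc⟩ | ⟨ha, hb, hc⟩ | ⟨ha, hb, hc⟩
  · exact absurd (ha ▸ hb ▸ rab') h01
  · exact absurd (ha ▸ hb ▸ rbc') h34
  all_goals
    rw [ha, hb] at rab'
    rw [ha, hc] at rac'
    rw [hb, hc] at rbc'
    exact ⟨_, _, by simp, by simp, rab', rac', rbc'⟩

/-- With `{0,3}` in the link of `5`, the triangle in the link of `6` is forced to be `0, 2, 3`, and
then no edge through `1` and `5` is possible. -/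
theorem not_link_zero_three (hH : CoversPairs H) (hN : PathFree H 3)
    (htri : ∀ v, ∃ i j k, H {v, i, j} ∧ H {v, i, k} ∧ H {v, j, k}) (f : Fin 7 ↪ U)
    (hA : pull H f {0, 1, 2}) (hB : pull H f {2, 3, 4}) (hD : pull H f {2, 5, 6}) :
    ¬ pull H f {0, 3, 5} := by
  intro h03
  have hF := hN.pull f
  obtain ⟨a, c, ha, hc, ra, rac, rc⟩ := exists_link_triangle_through_middle hH hN htri
    ((Equiv.swap 5 6).toEmbedding.trans f) (pull_trans hA _ (by decide))
    (pull_trans hB _ (by decide)) (pull_trans hD _ (by decide))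
  obtain rfl : a = 0 := ha.resolve_right fun h => by
    subst h
    exact hF.three h03 hB (pull_of_trans ra (t := {1, 2, 6}) (by decide)) (by decide)
  obtain rfl : c = 3 := hc.resolve_right fun h => by
    subst h
    exact hF.three h03 hA (pull_of_trans rc (t := {2, 4, 6}) (by decide)) (by decide)
  replace ra : pull H f {0, 2, 6} := pull_of_trans ra (by decide)
  replace rac : pull H f {0, 3, 6} := pull_of_trans rac (by decide)
  -- Now the pair `1, 5` is not covered.
  rcases hH.pull f 1 5 (by decide) with ⟨k, k1, k5, hk⟩ | ⟨d, hd, hk⟩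
  · fin_cases k <;> first
      | exact absurd rfl k1
      | exact absurd rfl k5
      | exact hF.three hB hD hk (by decide)
      | exact hF.three hk hB rac (by decide)
      | exact hF.three hk hA hB (by decide)
      | exact hF.three hk hB ra (by decide)
  · exact (hN.pull _).three hk (pull_snoc hA d hd) (pull_snoc hB d hd) (by decide)

/-- A set of triples on at least seven points that covers pairs contains a linear path of length
three if every link has a triangle. -/
theorem not_pathFree_three [Fintype U] (hH : CoversPairs H)
    (htri : ∀ v, ∃ i j k, H {v, i, j} ∧ H {v, i, k} ∧ H {v, j, k})
    (hU : 7 ≤ Fintype.card U) : ¬ PathFree H 3 := by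
  intro hN
  obtain ⟨f₀, hf₀⟩ := exists_embedding_of_not_pathFree hH.card_eq (by norm_num)
    (not_pathFree_two hH (by omega))
  have hA₀ : pull H f₀ {0, 1, 2} := hf₀ 0
  have hB₀ : pull H f₀ {2, 3, 4} := hf₀ 1
  obtain ⟨d, hd⟩ := exists_new_point f₀ (by omega)
  obtain ⟨d', hd'⟩ := exists_new_point (snoc f₀ d hd) (by omega)
  have hA₁ := pull_snoc (pull_snoc hA₀ d hd) d' hd'
  have hB₁ := pull_snoc (pull_snoc hB₀ d hd) d' hd'
  generalize snoc (snoc f₀ d hd) d' hd' = f at hA₁ hB₁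
  have hA : pull H f {0, 1, 2} := pull_congr hA₁ (by decide)
  have hB : pull H f {2, 3, 4} := pull_congr hB₁ (by decide)
  have hF := hN.pull f
  have hD : pull H f {2, 5, 6} := by
    rcases hH.pull f 5 6 (by decide) with ⟨k, k5, k6, hk⟩ | ⟨d, hd, hk⟩
    · fin_cases k <;> first
        | exact absurd rfl k5
        | exact absurd rfl k6
        | exact pull_congr hk (by decide)
        | exact (hF.three hk hA hB (by decide)).elim
        | exact (hF.three hk hB hA (by decide)).elim
    · exact (not_outer_three hH hN _ (pull_congr (pull_snoc hA d hd) (by decide))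
        (pull_congr (pull_snoc hB d hd) (by decide)) hk).elim
  obtain ⟨a, c, ha, hc, -, rac, -⟩ := exists_link_triangle_through_middle hH hN htri f hA hB hD
  -- The paths and `5, 6` are preserved by exchanging `0, 1` and by exchanging `3, 4`.
  rcases ha with rfl | rfl <;> rcases hc with rfl | rfl
  · exact not_link_zero_three hH hN htri f hA hB hD rac
  · exact not_link_zero_three hH hN htri ((Equiv.swap 3 4).toEmbedding.trans f)
      (pull_trans hA _ (by decide)) (pull_trans hB _ (by decide)) (pull_trans hD _ (by decide))
      (pull_trans rac _ (by decide))
  · exact not_link_zero_three hH hN htri ((Equiv.swap 0 1).toEmbedding.trans f)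
      (pull_trans hA _ (by decide)) (pull_trans hB _ (by decide)) (pull_trans hD _ (by decide))
      (pull_trans rac _ (by decide))
  · exact not_link_zero_three hH hN htri
      ((Equiv.swap 0 1 * Equiv.swap 3 4 : Equiv.Perm (Fin 7)).toEmbedding.trans f)
      (pull_trans hA _ (by decide)) (pull_trans hB _ (by decide)) (pull_trans hD _ (by decide))
      (pull_trans rac _ (by decide))

/-! ### Linear paths of length four: edges off a path of length three -/

/-- If the path `{0,1,2}, {2,3,4}, {4,5,6}` cannot be extended and `{7,8,9}` is an edge off it, then
there are only two possible edges through `0` and a point `x` of `{7,8,9}`. -/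
theorem pull_zero_of_outer_four (hH : CoversPairs H) (hN : PathFree H 4) (f : Fin 10 ↪ U)
    (hA : pull H f {0, 1, 2}) (hB : pull H f {2, 3, 4}) (hC : pull H f {4, 5, 6})
    (hT : pull H f {7, 8, 9}) (x : Fin 10) (hx : x = 7 ∨ x = 8 ∨ x = 9) :
    pull H f {0, 1, x} ∨ pull H f {0, 4, x} := by
  have hF := hN.pull f
  rcases hH.pull f 0 x (by rcases hx with rfl | rfl | rfl <;> decide) with
    ⟨k, k0, kx, hk⟩ | ⟨d, hd, hk⟩
  · rcases hx with rfl | rfl | rfl <;> fin_cases k <;> first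
      | exact absurd rfl k0
      | exact absurd rfl kx
      | exact Or.inl (pull_congr hk (by decide))
      | exact Or.inr (pull_congr hk (by decide))
      | exact (hF.four hT hk hB hC (by decide)).elim
      | exact (hF.four hT hk hC hB (by decide)).elim
      | exact (hF.four hk hA hB hC (by decide)).elim
  · exact ((hN.pull _).four hk (pull_snoc hA d hd) (pull_snoc hB d hd) (pull_snoc hC d hd)
      (by rcases hx with rfl | rfl | rfl <;> decide)).elim

/-- A path of length three that cannot be extended has no edge off it: otherwise there is no
possible edge through the midpoint `3` and a point of that edge. -/
theorem not_outer_four (hH : CoversPairs H) (hN : PathFree H 4) (f : Fin 10 ↪ U)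
    (hA : pull H f {0, 1, 2}) (hB : pull H f {2, 3, 4}) (hC : pull H f {4, 5, 6}) :
    ¬ pull H f {7, 8, 9} := by
  intro hT
  have hF := hN.pull f
  have h0 := pull_zero_of_outer_four hH hN f hA hB hC hT
  have h6 : ∀ x : Fin 10, x = 7 ∨ x = 8 ∨ x = 9 →
      pull H f {5, 6, x} ∨ pull H f {2, 6, x} := by
    intro x hx
    refine (pull_zero_of_outer_four hH hN ((Equiv.swap 0 6 * Equiv.swap 1 5 * Equiv.swap 2 4 :
      Equiv.Perm (Fin 10)).toEmbedding.trans f) (pull_trans hC _ (by decide))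
      (pull_trans hB _ (by decide)) (pull_trans hA _ (by decide)) (pull_trans hT _ (by decide))
      x hx).imp (fun h => pull_of_trans h ?_) (fun h => pull_of_trans h ?_)
    all_goals rcases hx with rfl | rfl | rfl <;> decide
  -- Either all edges through `0` or `6` and a point `x` of `{7,8,9}` are `{0,4,x}` or `{2,6,x}`, or
  -- all of them are `{0,1,x}` or `{5,6,x}`.
  by_cases hmix : pull H f {0, 4, 7} ∧ pull H f {0, 4, 8} ∧ pull H f {2, 6, 8} ∧ pull H f {2, 6, 9}
  · obtain ⟨h7, h8, g8, g9⟩ := hmix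
    rcases hH.pull f 3 7 (by decide) with ⟨k, k3, k7, hk⟩ | ⟨d, hd, hk⟩
    · fin_cases k <;> first
        | exact absurd rfl k3
        | exact absurd rfl k7
        | exact hF.four hT hk hB hC (by decide)
        | exact hF.four hT hk hB hA (by decide)
        | exact hF.four hk hA h8 hC (by decide)
        | exact hF.four hk hC g8 hA (by decide)
        | exact hF.four hk h7 hA g9 (by decide)
        | exact hF.four hk h7 hA g8 (by decide)
    · exact (hN.pull _).four hk (pull_snoc h7 d hd) (pull_snoc hA d hd) (pull_snoc g8 d hd)
        (by decide)
  · have hpure : pull H f {5, 6, 7} ∧ pull H f {0, 1, 8} ∧ pull H f {5, 6, 8} := by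
      have a78 := fun a b => hF.four hA (b := {0, 4, 7}) a hT (d := {5, 6, 8}) b (by decide)
      have a79 := fun a b => hF.four hA (b := {0, 4, 7}) a hT (d := {5, 6, 9}) b (by decide)
      have a87 := fun a b => hF.four hA (b := {0, 4, 8}) a hT (d := {5, 6, 7}) b (by decide)
      have a89 := fun a b => hF.four hA (b := {0, 4, 8}) a hT (d := {5, 6, 9}) b (by decide)
      have a97 := fun a b => hF.four hA (b := {0, 4, 9}) a hT (d := {5, 6, 7}) b (by decide)
      have a98 := fun a b => hF.four hA (b := {0, 4, 9}) a hT (d := {5, 6, 8}) b (by decide)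
      have b78 := fun a b => hF.four hC (b := {2, 6, 7}) a hT (d := {0, 1, 8}) b (by decide)
      have b79 := fun a b => hF.four hC (b := {2, 6, 7}) a hT (d := {0, 1, 9}) b (by decide)
      have b87 := fun a b => hF.four hC (b := {2, 6, 8}) a hT (d := {0, 1, 7}) b (by decide)
      have b89 := fun a b => hF.four hC (b := {2, 6, 8}) a hT (d := {0, 1, 9}) b (by decide)
      have b97 := fun a b => hF.four hC (b := {2, 6, 9}) a hT (d := {0, 1, 7}) b (by decide)
      have b98 := fun a b => hF.four hC (b := {2, 6, 9}) a hT (d := {0, 1, 8}) b (by decide)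
      have c7 := h0 7 (by simp)
      have c8 := h0 8 (by simp)
      have c9 := h0 9 (by simp)
      have d7 := h6 7 (by simp)
      have d8 := h6 8 (by simp)
      have d9 := h6 9 (by simp)
      grind
    obtain ⟨g7, h8, g8⟩ := hpure
    rcases hH.pull f 3 7 (by decide) with ⟨k, k3, k7, hk⟩ | ⟨d, hd, hk⟩
    · fin_cases k <;> first
        | exact absurd rfl k3
        | exact absurd rfl k7
        | exact hF.four hT hk hB hC (by decide)
        | exact hF.four hT hk hB hA (by decide)
        | exact hF.four hA hk hT g8 (by decide)
        | exact hF.four hC hk hT h8 (by decide)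
        | exact hF.four g7 hk hB hA (by decide)
    · exact (hN.pull _).four (pull_snoc g7 d hd) hk (pull_snoc hB d hd) (pull_snoc hA d hd)
        (by decide)

/-- If the path `{0,1,2}, {2,3,4}, {4,5,6}` cannot be extended and an edge leaves `7` and the path,
then it returns to one of the points `2, 3, 4`. -/
theorem mem_middle_of_outer_four (hH : CoversPairs H) (hN : PathFree H 4) (g : Fin 8 ↪ U)
    (hA : pull H g {0, 1, 2}) (hB : pull H g {2, 3, 4}) (hC : pull H g {4, 5, 6}) {i j : U}
    (hij : H {g 7, i, j}) (hi : ∀ m, g m ≠ i) : ∃ m : Fin 8, (m = 2 ∨ m = 3 ∨ m = 4) ∧ g m = j := by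
  have hA' := pull_snoc hA i hi
  have hB' := pull_snoc hB i hi
  have hC' := pull_snoc hC i hi
  by_cases hj : ∃ m, g m = j
  · obtain ⟨m, rfl⟩ := hj
    have hm : pull H (snoc g i hi) {7, 8, m.castSucc} := by
      rw [pull, Finset.map_insert, Finset.map_insert, Finset.map_singleton, snoc_castSucc]
      have e7 : snoc g i hi 7 = g 7 := snoc_castSucc g i hi 7
      have e8 : snoc g i hi 8 = i := snoc_last g i hi
      rwa [e7, e8]
    have hF := hN.pull (snoc g i hi)
    have h7 := (hH.ne hij).2.1
    refine ⟨m, ?_, rfl⟩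
    fin_cases m <;> first
      | decide
      | exact absurd rfl h7
      | exact (hF.four hm hA' hB' hC' (by decide)).elim
      | exact (hF.four hm hC' hB' hA' (by decide)).elim
  · push Not at hj
    have hj' : ∀ m, snoc g i hi m ≠ j := by
      intro m
      refine Fin.lastCases ?_ (fun m => ?_) m
      · rw [snoc_last]
        exact (hH.ne hij).2.2
      · rw [snoc_castSucc]
        exact hj m
    refine (not_outer_four hH hN (snoc (snoc g i hi) j hj')
      (pull_congr (pull_snoc hA' j hj') (by decide))
      (pull_congr (pull_snoc hB' j hj') (by decide))
      (pull_congr (pull_snoc hC' j hj') (by decide)) ?_).elim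
    rw [pull, Finset.map_insert, Finset.map_insert, Finset.map_singleton]
    have e7 : snoc (snoc g i hi) j hj' 7 = g 7 :=
      (snoc_castSucc (snoc g i hi) j hj' 7).trans (snoc_castSucc g i hi 7)
    have e8 : snoc (snoc g i hi) j hj' 8 = i :=
      (snoc_castSucc (snoc g i hi) j hj' 8).trans (snoc_last g i hi)
    have e9 : snoc (snoc g i hi) j hj' 9 = j := snoc_last _ j hj'
    rwa [e7, e8, e9]

/-- A triangle of the link of `7` that avoids the path vertex `u` either lies on the path, or has
a vertex off the path and then an edge among the points `2, 3, 4`. -/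
theorem exists_link_triangle_four (hH : CoversPairs H) (hN : PathFree H 4)
    (htri : ∀ v u, u ≠ v → ∃ i j k, i ≠ u ∧ j ≠ u ∧ k ≠ u ∧
      H {v, i, j} ∧ H {v, i, k} ∧ H {v, j, k}) (g : Fin 8 ↪ U)
    (hA : pull H g {0, 1, 2}) (hB : pull H g {2, 3, 4}) (hC : pull H g {4, 5, 6})
    (u : Fin 8) (hu : u < 7) :
    (∃ a b c : Fin 8, a < b ∧ b < c ∧ c < 7 ∧ a ≠ u ∧ b ≠ u ∧ c ≠ u ∧
      pull H g {a, b, 7} ∧ pull H g {a, c, 7} ∧ pull H g {b, c, 7}) ∨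
    ∃ a b : Fin 8, a ≠ b ∧ a ≠ u ∧ b ≠ u ∧ (a = 2 ∨ a = 3 ∨ a = 4) ∧ (b = 2 ∨ b = 3 ∨ b = 4) ∧
      pull H g {a, b, 7} := by
  obtain ⟨i, j, k, hiu, hju, hku, hij, hik, hjk⟩ := htri (g 7) (g u)
    (fun h => hu.ne (g.injective h))
  have hji : H {g 7, j, i} := by rwa [Finset.pair_comm]
  have hki : H {g 7, k, i} := by rwa [Finset.pair_comm]
  have hkj : H {g 7, k, j} := by rwa [Finset.pair_comm]
  have conv : ∀ x y : Fin 8, H {g 7, g x, g y} → pull H g {x, y, 7} := by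
    intro x y h
    rw [pull, Finset.map_insert, Finset.map_insert, Finset.map_singleton]
    rwa [Finset.insert_comm, Finset.pair_comm (g 7)] at h
  rw [or_iff_not_imp_right]
  intro hno
  have key : ∀ x y z, y ≠ g u → z ≠ g u → H {g 7, x, y} → H {g 7, x, z} → H {g 7, y, z} →
      ∃ m, g m = x := by
    intro x y z hy hz hxy hxz hyz
    by_contra hx
    push Not at hx
    obtain ⟨a, ha, rfl⟩ := mem_middle_of_outer_four hH hN g hA hB hC hxy hx
    obtain ⟨b, hb, rfl⟩ := mem_middle_of_outer_four hH hN g hA hB hC hxz hx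
    exact hno ⟨a, b, fun e => (hH.ne hyz).2.2 (congrArg g e), fun e => hy (congrArg g e),
      fun e => hz (congrArg g e), ha, hb, conv _ _ hyz⟩
  obtain ⟨a, rfl⟩ := key i j k hju hku hij hik hjk
  obtain ⟨b, rfl⟩ := key j _ k hiu hku hji hjk hik
  obtain ⟨c, rfl⟩ := key k _ _ hiu hju hki hkj hij
  have lt : ∀ x : Fin 8, g 7 ≠ g x → x < 7 := by
    intro x hx
    rcases lt_or_eq_of_le (Fin.le_last x) with h | rfl
    · exact h
    · exact absurd rfl hx
  obtain ⟨a, b, c, h1, h2, q1, q2, q3, h3, h4⟩ := exists_increasing_triple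
    (R := fun x y => pull H g {x, y, 7}) (fun x y h => by rwa [Finset.insert_comm] at h)
    (Q := fun x => x < 7 ∧ x ≠ u)
    (fun e => (hH.ne hij).2.2 (congrArg g e)) (fun e => (hH.ne hik).2.2 (congrArg g e))
    (fun e => (hH.ne hjk).2.2 (congrArg g e))
    ⟨lt _ (hH.ne hij).1, fun e => hiu (congrArg g e)⟩
    ⟨lt _ (hH.ne hij).2.1, fun e => hju (congrArg g e)⟩
    ⟨lt _ (hH.ne hjk).2.1, fun e => hku (congrArg g e)⟩ (conv _ _ hij) (conv _ _ hik) (conv _ _ hjk)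
  exact ⟨a, b, c, h1, h2, q3.1, q1.2, q2.2, q3.2, h3, h4⟩

theorem increasing_triple_lt_seven : ∀ a b c : Fin 9, a < b → b < c → c < 7 →
    a ≠ 2 → b ≠ 2 → c ≠ 2 → (a = 0 ∧ b = 1) ∨ (a = 3 ∧ b = 4) ∨ (b = 3 ∧ c = 4) ∨
      ((a = 0 ∨ a = 1) ∧ (b = 3 ∨ b = 4) ∧ (c = 5 ∨ c = 6)) ∨
      ((a = 0 ∨ a = 1 ∨ a = 3 ∨ a = 4) ∧ b = 5 ∧ c = 6) := by
  decide

/-- The triangles in the link of `7` that avoid `2`. -/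
theorem link_triangle_avoiding_two (hH : CoversPairs H) (hN : PathFree H 4)
    (htri : ∀ v u, u ≠ v → ∃ i j k, i ≠ u ∧ j ≠ u ∧ k ≠ u ∧
      H {v, i, j} ∧ H {v, i, k} ∧ H {v, j, k}) (f : Fin 9 ↪ U)
    (hA : pull H f {0, 1, 2}) (hB : pull H f {2, 3, 4}) (hC : pull H f {4, 5, 6}) :
    pull H f {0, 1, 7} ∨ pull H f {3, 4, 7} ∨
    (pull H f {5, 6, 7} ∧ ∃ x : Fin 9, (x = 0 ∨ x = 1 ∨ x = 3 ∨ x = 4) ∧ pull H f {x, 5, 7}) ∨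
    ∃ a b c : Fin 9, (a = 0 ∨ a = 1) ∧ (b = 3 ∨ b = 4) ∧ (c = 5 ∨ c = 6) ∧
      pull H f {a, b, 7} ∧ pull H f {a, c, 7} ∧ pull H f {b, c, 7} := by
  rcases exists_link_triangle_four hH hN htri (Fin.castSuccEmb.trans f)
    (pull_trans hA _ (by decide)) (pull_trans hB _ (by decide)) (pull_trans hC _ (by decide)) 2
    (by decide) with ⟨a, b, c, hab, hbc, hc7, ha2, hb2, hc2, rab, rac, rbc⟩ |
      ⟨a, b, hab, ha2, hb2, ha, hb, rab⟩
  · have rab' : pull H f {a.castSucc, b.castSucc, 7} := pull_of_trans rab (by simp)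
    have rac' : pull H f {a.castSucc, c.castSucc, 7} := pull_of_trans rac (by simp)
    have rbc' : pull H f {b.castSucc, c.castSucc, 7} := pull_of_trans rbc (by simp)
    rcases increasing_triple_lt_seven a.castSucc b.castSucc c.castSucc hab hbc hc7
      (fun h => ha2 (Fin.castSucc_injective _ h)) (fun h => hb2 (Fin.castSucc_injective _ h))
      (fun h => hc2 (Fin.castSucc_injective _ h)) with
      ⟨ha, hb⟩ | ⟨ha, hb⟩ | ⟨hb, hc⟩ | ⟨ha, hb, hc⟩ | ⟨ha, hb, hc⟩
    · rw [ha, hb] at rab'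
      exact Or.inl rab'
    · rw [ha, hb] at rab'
      exact Or.inr (Or.inl rab')
    · rw [hb, hc] at rbc'
      exact Or.inr (Or.inl rbc')
    · exact Or.inr (Or.inr (Or.inr ⟨_, _, _, ha, hb, hc, rab', rac', rbc'⟩))
    · rw [hb] at rab'
      rw [hb, hc] at rbc'
      exact Or.inr (Or.inr (Or.inl ⟨rbc', _, ha, rab'⟩))
  · refine Or.inr (Or.inl (pull_of_trans rab ?_))
    rcases ha with rfl | rfl | rfl <;> rcases hb with rfl | rfl | rfl <;>
      first
        | exact absurd rfl hab
        | exact absurd rfl ha2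
        | exact absurd rfl hb2
        | decide

/-- The order-reversing symmetry of the path. -/
abbrev rev : Equiv.Perm (Fin 9) := Equiv.swap 0 6 * Equiv.swap 1 5 * Equiv.swap 2 4

/-- The triangles in the link of `7` that avoid `4`. -/
theorem link_triangle_avoiding_four (hH : CoversPairs H) (hN : PathFree H 4)
    (htri : ∀ v u, u ≠ v → ∃ i j k, i ≠ u ∧ j ≠ u ∧ k ≠ u ∧
      H {v, i, j} ∧ H {v, i, k} ∧ H {v, j, k}) (f : Fin 9 ↪ U)
    (hA : pull H f {0, 1, 2}) (hB : pull H f {2, 3, 4}) (hC : pull H f {4, 5, 6}) :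
    pull H f {0, 1, 7} ∨ pull H f {5, 6, 7} ∨ pull H f {2, 3, 7} ∨
    ∃ a b c : Fin 9, (a = 0 ∨ a = 1) ∧ (b = 2 ∨ b = 3) ∧ (c = 5 ∨ c = 6) ∧
      pull H f {a, b, 7} ∧ pull H f {a, c, 7} ∧ pull H f {b, c, 7} := by
  rcases link_triangle_avoiding_two hH hN htri (rev.toEmbedding.trans f)
    (pull_trans hC _ (by decide)) (pull_trans hB _ (by decide)) (pull_trans hA _ (by decide)) with
    h | h | ⟨h, -⟩ | ⟨a, b, c, ha, hb, hc, rab, rac, rbc⟩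
  · exact Or.inr (Or.inl (pull_of_trans h (by decide)))
  · exact Or.inr (Or.inr (Or.inl (pull_of_trans h (by decide))))
  · exact Or.inl (pull_of_trans h (by decide))
  · refine Or.inr (Or.inr (Or.inr ⟨rev c, rev b, rev a, ?_, ?_, ?_, pull_of_trans rbc ?_,
      pull_of_trans rac ?_, pull_of_trans rab ?_⟩))
    all_goals
      rcases ha with rfl | rfl <;> rcases hb with rfl | rfl <;> rcases hc with rfl | rfl <;> decide

/-! ### Linear paths of length four: the links of two points off the path -/

/-- The path `{0,1,2}, {2,3,4}, {4,5,6}` and two further points `7, 8` in a `P_4`-free set of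
triples that covers pairs and in which no point of the link of a point lies on all triangles of
this link. -/
structure PathConfig (H : Finset U → Prop) (f : Fin 9 ↪ U) : Prop where
  coversPairs : CoversPairs H
  pathFree : PathFree H 4
  triangle : ∀ v u, u ≠ v → ∃ i j k, i ≠ u ∧ j ≠ u ∧ k ≠ u ∧
    H {v, i, j} ∧ H {v, i, k} ∧ H {v, j, k}
  left : pull H f {0, 1, 2}
  middle : pull H f {2, 3, 4}
  right : pull H f {4, 5, 6}

namespace PathConfig

variable {f : Fin 9 ↪ U}

theorem trans (h : PathConfig H f) (σ : Fin 9 ↪ Fin 9)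
    (hl : ({0, 1, 2} : Finset (Fin 9)).map σ = {0, 1, 2})
    (hm : ({2, 3, 4} : Finset (Fin 9)).map σ = {2, 3, 4})
    (hr : ({4, 5, 6} : Finset (Fin 9)).map σ = {4, 5, 6}) : PathConfig H (σ.trans f) :=
  ⟨h.coversPairs, h.pathFree, h.triangle, pull_trans h.left σ hl, pull_trans h.middle σ hm,
    pull_trans h.right σ hr⟩

theorem rev (h : PathConfig H f) : PathConfig H (rev.toEmbedding.trans f) :=
  ⟨h.coversPairs, h.pathFree, h.triangle, pull_trans h.right _ (by decide),
    pull_trans h.middle _ (by decide), pull_trans h.left _ (by decide)⟩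

theorem swap (h : PathConfig H f) : PathConfig H ((Equiv.swap 7 8).toEmbedding.trans f) :=
  h.trans _ (by decide) (by decide) (by decide)

theorem free (h : PathConfig H f) : PathFree (pull H f) 4 :=
  h.pathFree.pull f

theorem triangle_avoiding_two (h : PathConfig H f) :
    pull H f {0, 1, 7} ∨ pull H f {3, 4, 7} ∨
    (pull H f {5, 6, 7} ∧ ∃ x : Fin 9, (x = 0 ∨ x = 1 ∨ x = 3 ∨ x = 4) ∧ pull H f {x, 5, 7}) ∨
    ∃ a b c : Fin 9, (a = 0 ∨ a = 1) ∧ (b = 3 ∨ b = 4) ∧ (c = 5 ∨ c = 6) ∧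
      pull H f {a, b, 7} ∧ pull H f {a, c, 7} ∧ pull H f {b, c, 7} :=
  link_triangle_avoiding_two h.coversPairs h.pathFree h.triangle f h.left h.middle h.right

theorem triangle_avoiding_four (h : PathConfig H f) :
    pull H f {0, 1, 7} ∨ pull H f {5, 6, 7} ∨ pull H f {2, 3, 7} ∨
    ∃ a b c : Fin 9, (a = 0 ∨ a = 1) ∧ (b = 2 ∨ b = 3) ∧ (c = 5 ∨ c = 6) ∧
      pull H f {a, b, 7} ∧ pull H f {a, c, 7} ∧ pull H f {b, c, 7} :=
  link_triangle_avoiding_four h.coversPairs h.pathFree h.triangle f h.left h.middle h.right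

theorem triangle_avoiding_two' (h : PathConfig H f) :
    pull H f {0, 1, 8} ∨ pull H f {3, 4, 8} ∨
    (pull H f {5, 6, 8} ∧ ∃ x : Fin 9, (x = 0 ∨ x = 1 ∨ x = 3 ∨ x = 4) ∧ pull H f {x, 5, 8}) ∨
    ∃ a b c : Fin 9, (a = 0 ∨ a = 1) ∧ (b = 3 ∨ b = 4) ∧ (c = 5 ∨ c = 6) ∧
      pull H f {a, b, 8} ∧ pull H f {a, c, 8} ∧ pull H f {b, c, 8} := by
  rcases h.swap.triangle_avoiding_two with h | h | ⟨h, x, hx, h'⟩ |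
    ⟨a, b, c, ha, hb, hc, rab, rac, rbc⟩
  · exact Or.inl (pull_of_trans h (by decide))
  · exact Or.inr (Or.inl (pull_of_trans h (by decide)))
  · refine Or.inr (Or.inr (Or.inl ⟨pull_of_trans h (by decide), x, hx, pull_of_trans h' ?_⟩))
    rcases hx with rfl | rfl | rfl | rfl <;> decide
  · refine Or.inr (Or.inr (Or.inr ⟨a, b, c, ha, hb, hc, pull_of_trans rab ?_,
      pull_of_trans rac ?_, pull_of_trans rbc ?_⟩))
    all_goals
      rcases ha with rfl | rfl <;> rcases hb with rfl | rfl <;> rcases hc with rfl | rfl <;> decide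

theorem triangle_avoiding_four' (h : PathConfig H f) :
    pull H f {0, 1, 8} ∨ pull H f {5, 6, 8} ∨ pull H f {2, 3, 8} ∨
    ∃ a b c : Fin 9, (a = 0 ∨ a = 1) ∧ (b = 2 ∨ b = 3) ∧ (c = 5 ∨ c = 6) ∧
      pull H f {a, b, 8} ∧ pull H f {a, c, 8} ∧ pull H f {b, c, 8} := by
  rcases h.swap.triangle_avoiding_four with h | h | h | ⟨a, b, c, ha, hb, hc, rab, rac, rbc⟩
  · exact Or.inl (pull_of_trans h (by decide))
  · exact Or.inr (Or.inl (pull_of_trans h (by decide)))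
  · exact Or.inr (Or.inr (Or.inl (pull_of_trans h (by decide))))
  · refine Or.inr (Or.inr (Or.inr ⟨a, b, c, ha, hb, hc, pull_of_trans rab ?_,
      pull_of_trans rac ?_, pull_of_trans rbc ?_⟩))
    all_goals
      rcases ha with rfl | rfl <;> rcases hb with rfl | rfl <;> rcases hc with rfl | rfl <;> decide

/-! #### The pair `7, 8` covered by the midpoint `3` of the path -/

/-- If the edge `{3,7,8}` is present, the pair `0, 5` belongs to both links or to none. -/
theorem zero_five_of_mid (h : PathConfig H f) (hD : pull H f {3, 7, 8})
    (h05 : pull H f {0, 5, 7}) : pull H f {0, 5, 8} := by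
  have hF := h.free
  have A := h.left
  have B := h.middle
  have C := h.right
  by_contra hno
  rcases h.triangle_avoiding_two' with h1 | h1 | ⟨h1, -⟩ | ⟨a, b, c, ha, hb, hc, rab, rac, rbc⟩
  · exact hF.four C B hD h1 (by decide)
  · exact hF.four h1 C h05 A (by decide)
  · exact hF.four A B hD h1 (by decide)
  have h145 : pull H f {1, 4, 8} ∧ pull H f {1, 5, 8} ∧ pull H f {4, 5, 8} := by
    rcases ha with rfl | rfl <;> rcases hb with rfl | rfl <;> rcases hc with rfl | rfl <;> first
      | exact absurd rac hno
      | exact ⟨rab, rac, rbc⟩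
      | exact (hF.four h05 A B rbc (by decide)).elim
      | exact (hF.four rab A h05 C (by decide)).elim
  obtain ⟨h14, h15, h45⟩ := h145
  have h06 : pull H f {0, 6, 8} := by
    rcases h.triangle_avoiding_four' with h1 | h1 | h1 |
      ⟨a, b, c, ha, hb, hc, rab, rac, rbc⟩
    · exact (hF.four C B hD h1 (by decide)).elim
    · exact (hF.four A B hD h1 (by decide)).elim
    · exact (hF.four h1 A h05 C (by decide)).elim
    rcases ha with rfl | rfl <;> rcases hb with rfl | rfl <;> rcases hc with rfl | rfl <;> first
      | exact absurd rac hno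
      | exact rac
      | exact (hF.four rab B C h05 (by decide)).elim
  rcases h.triangle_avoiding_two with h1 | h1 | ⟨h1, -⟩ | ⟨a, b, c, ha, hb, hc, rab, rac, rbc⟩
  · exact hF.four C B hD h1 (by decide)
  · exact hF.four h1 C h15 A (by decide)
  · exact hF.four A B hD h1 (by decide)
  rcases ha with rfl | rfl <;> rcases hb with rfl | rfl <;> rcases hc with rfl | rfl <;> first
    | exact hF.four rab A h15 C (by decide)
    | exact hF.four rab A h06 C (by decide)
    | exact hF.four h06 A B rbc (by decide)
    | exact hF.four h15 A B rbc (by decide)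

/-- If `0, 5` is in both links, then `1, 4` is in the link of `8` and `2, 6` in the link of `7`,
which gives a longer path. -/
theorem not_zero_five_of_mid (h : PathConfig H f) (hD : pull H f {3, 7, 8}) :
    ¬ pull H f {0, 5, 7} := by
  intro h05
  have g05 := h.zero_five_of_mid hD h05
  have hF := h.free
  have A := h.left
  have B := h.middle
  have C := h.right
  have g15 : ¬ pull H f {1, 5, 8} := by
    intro g15
    rcases h.triangle_avoiding_four with h1 | h1 | h1 | ⟨a, b, c, ha, hb, hc, rab, rac, rbc⟩
    · exact hF.four C B hD h1 (by decide)
    · exact hF.four A B hD h1 (by decide)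
    · exact hF.four h1 A g05 C (by decide)
    rcases ha with rfl | rfl <;> rcases hb with rfl | rfl <;> first
      | exact hF.four rab A g15 C (by decide)
      | exact hF.four rab A g05 C (by decide)
      | exact hF.four rab B C g15 (by decide)
      | exact hF.four rab B C g05 (by decide)
  have g16 : ¬ pull H f {1, 6, 8} := by
    intro g16
    rcases h.triangle_avoiding_two with h1 | h1 | ⟨h1, -⟩ | ⟨a, b, c, ha, hb, hc, rab, rac, rbc⟩
    · exact hF.four C B hD h1 (by decide)
    · exact hF.four h1 C g05 A (by decide)
    · exact hF.four A B hD h1 (by decide)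
    rcases ha with rfl | rfl <;> rcases hb with rfl | rfl <;> rcases hc with rfl | rfl <;> first
      | exact hF.four rab A g16 C (by decide)
      | exact hF.four rab A g05 C (by decide)
      | exact hF.four g16 A B rbc (by decide)
      | exact hF.four g05 A B rbc (by decide)
  have h6 : ∀ x : Fin 9, x = 0 ∨ x = 1 → ¬ pull H f {x, 6, 7} := by
    intro x hx hx6
    rcases h.triangle_avoiding_two' with h1 | h1 | ⟨h1, -⟩ | ⟨a, b, c, ha, hb, hc, rab, rac, rbc⟩
    · exact hF.four C B hD h1 (by decide)
    · exact hF.four h1 C h05 A (by decide)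
    · exact hF.four A B hD h1 (by decide)
    rcases hx with rfl | rfl <;> rcases hb with rfl | rfl <;> rcases hc with rfl | rfl <;> first
      | exact hF.four rbc C hx6 A (by decide)
      | exact hF.four rbc C h05 A (by decide)
      | exact hF.four hx6 A B rbc (by decide)
      | exact hF.four h05 A B rbc (by decide)
  have g14 : pull H f {1, 4, 8} := by
    rcases h.coversPairs.pull f 1 8 (by decide) with ⟨k, k1, k8, hk⟩ | ⟨d, hd, hk⟩
    · fin_cases k <;> first
        | exact absurd rfl k1
        | exact absurd rfl k8
        | exact absurd (pull_congr hk (by decide)) g15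
        | exact absurd (pull_congr hk (by decide)) g16
        | exact pull_congr hk (by decide)
        | exact (hF.four C B hD hk (by decide)).elim
        | exact (hF.four hk B C h05 (by decide)).elim
        | exact (hF.four hk A h05 C (by decide)).elim
        | exact (hF.four hk A B C (by decide)).elim
    · exact ((h.pathFree.pull _).four hk (pull_snoc A d hd) (pull_snoc B d hd) (pull_snoc C d hd)
        (by decide)).elim
  have h26 : pull H f {2, 6, 7} := by
    rcases h.coversPairs.pull f 6 7 (by decide) with ⟨k, k6, k7, hk⟩ | ⟨d, hd, hk⟩
    · fin_cases k <;> first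
        | exact absurd rfl k6
        | exact absurd rfl k7
        | exact absurd (pull_congr hk (by decide)) (h6 0 (by decide))
        | exact absurd (pull_congr hk (by decide)) (h6 1 (by decide))
        | exact pull_congr hk (by decide)
        | exact (hF.four A B hD hk (by decide)).elim
        | exact (hF.four g05 A B hk (by decide)).elim
        | exact (hF.four hk C B A (by decide)).elim
    · exact ((h.pathFree.pull _).four hk (pull_snoc C d hd) (pull_snoc B d hd) (pull_snoc A d hd)
        (by decide)).elim
  exact hF.four g14 B h26 h05 (by decide)

theorem not_end_pair_of_mid (h : PathConfig H f) (hD : pull H f {3, 7, 8}) (a c : Fin 9)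
    (ha : a = 0 ∨ a = 1) (hc : c = 5 ∨ c = 6) : ¬ pull H f {a, c, 7} := by
  intro hac
  rcases ha with rfl | rfl <;> rcases hc with rfl | rfl
  · exact h.not_zero_five_of_mid hD hac
  · exact (h.trans (Equiv.swap 5 6).toEmbedding (by decide) (by decide)
      (by decide)).not_zero_five_of_mid (pull_trans hD _ (by decide)) (pull_trans hac _ (by decide))
  · exact (h.trans (Equiv.swap 0 1).toEmbedding (by decide) (by decide)
      (by decide)).not_zero_five_of_mid (pull_trans hD _ (by decide)) (pull_trans hac _ (by decide))
  · exact (h.trans (Equiv.swap 0 1 * Equiv.swap 5 6 : Equiv.Perm (Fin 9)).toEmbedding (by decide)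
      (by decide) (by decide)).not_zero_five_of_mid (pull_trans hD _ (by decide))
      (pull_trans hac _ (by decide))

/-- The edge `{3,7,8}` is impossible: without a pair joining the two ends of the path, the triangle
conditions leave only `3, 4` in the link of `7` and `2, 3` in the link of `8`. -/
theorem not_mid (h : PathConfig H f) : ¬ pull H f {3, 7, 8} := by
  intro hD
  have hF := h.free
  have A := h.left
  have B := h.middle
  have C := h.right
  have h34 : pull H f {3, 4, 7} := by
    rcases h.triangle_avoiding_two with h1 | h1 | ⟨h1, -⟩ | ⟨a, b, c, ha, hb, hc, rab, rac, rbc⟩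
    · exact (hF.four C B hD h1 (by decide)).elim
    · exact h1
    · exact (hF.four A B hD h1 (by decide)).elim
    · exact absurd rac (h.not_end_pair_of_mid hD a c ha hc)
  have g23 : pull H f {2, 3, 8} := by
    rcases h.triangle_avoiding_four' with h1 | h1 | h1 | ⟨a, b, c, ha, hb, hc, rab, rac, rbc⟩
    · exact (hF.four C B hD h1 (by decide)).elim
    · exact (hF.four A B hD h1 (by decide)).elim
    · exact h1
    · refine absurd (pull_trans rac (Equiv.swap 7 8).toEmbedding ?_)
        (h.swap.not_end_pair_of_mid (pull_trans hD _ (by decide)) a c ha hc)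
      rcases ha with rfl | rfl <;> rcases hc with rfl | rfl <;> decide
  exact hF.four A g23 h34 C (by decide)

/-! #### The pair `7, 8` covered by a joint `2` of the path -/

theorem not_five_six_of_joint (h : PathConfig H f) (hD : pull H f {2, 7, 8}) :
    ¬ pull H f {5, 6, 8} := by
  intro g56
  have hF := h.free
  have A := h.left
  have B := h.middle
  have C := h.right
  rcases h.triangle_avoiding_two with h1 | h1 | ⟨-, x, hx, h1⟩ |
    ⟨a, b, c, ha, hb, hc, rab, rac, rbc⟩
  · exact hF.four C B hD h1 (by decide)
  · exact hF.four A hD h1 C (by decide)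
  · rcases hx with rfl | rfl | rfl | rfl <;> first
      | exact hF.four g56 h1 A B (by decide)
      | exact hF.four g56 h1 B A (by decide)
  · rcases ha with rfl | rfl <;> rcases hc with rfl | rfl <;>
      exact hF.four g56 rac A B (by decide)

/-- If the edge `{2,7,8}` is present and `0, 5` is in the link of `7`, then the triangle in the link
of `8` that avoids `2` is `0, 4, 5`, and the edge covering `6` and `7` is `{2,6,7}`. -/
theorem link_of_joint (h : PathConfig H f) (hD : pull H f {2, 7, 8})
    (h05 : pull H f {0, 5, 7}) :
    pull H f {2, 6, 7} ∧ pull H f {0, 5, 8} ∧ pull H f {0, 4, 8} ∧ pull H f {4, 5, 8} := by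
  have hF := h.free
  have A := h.left
  have B := h.middle
  have C := h.right
  have h56 : ¬ pull H f {5, 6, 7} := fun h' =>
    h.swap.not_five_six_of_joint (pull_trans hD _ (by decide)) (pull_trans h' _ (by decide))
  rcases h.triangle_avoiding_two' with h1 | h1 | ⟨h1, -⟩ | ⟨a, b, c, ha, hb, hc, rab, rac, rbc⟩
  · exact (hF.four C B hD h1 (by decide)).elim
  · exact (hF.four A hD h1 C (by decide)).elim
  · exact absurd h1 (h.not_five_six_of_joint hD)
  have hbc : b = 4 ∧ c = 5 := by
    rcases hb with rfl | rfl <;> rcases hc with rfl | rfl <;> first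
      | exact ⟨rfl, rfl⟩
      | exact (hF.four A hD rbc C (by decide)).elim
      | exact (hF.four h05 A B rbc (by decide)).elim
  obtain ⟨rfl, rfl⟩ := hbc
  have h26 : pull H f {2, 6, 7} := by
    rcases h.coversPairs.pull f 6 7 (by decide) with ⟨k, k6, k7, hk⟩ | ⟨d, hd, hk⟩
    · fin_cases k <;> first
        | exact absurd rfl k6
        | exact absurd rfl k7
        | exact absurd (pull_congr hk (by decide)) h56
        | exact pull_congr hk (by decide)
        | exact (hF.four hk A B rbc (by decide)).elim
        | exact (hF.four A hD hk C (by decide)).elim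
        | exact (hF.four hk C B A (by decide)).elim
        | (rcases ha with rfl | rfl <;> exact (hF.four rac A B hk (by decide)).elim)
    · exact ((h.pathFree.pull _).four hk (pull_snoc C d hd) (pull_snoc B d hd) (pull_snoc A d hd)
        (by decide)).elim
  rcases ha with rfl | rfl
  · exact ⟨h26, rac, rab, rbc⟩
  · exact (hF.four rab B h26 h05 (by decide)).elim

theorem not_zero_five_of_joint (h : PathConfig H f) (hD : pull H f {2, 7, 8}) :
    ¬ pull H f {0, 5, 7} := by
  intro h05
  have hF := h.free
  have A := h.left
  have B := h.middle
  have C := h.right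
  obtain ⟨h26, g05, g04, g45⟩ := h.link_of_joint hD h05
  obtain ⟨g26', -, h04', h45'⟩ := h.swap.link_of_joint (pull_trans hD _ (by decide))
    (pull_trans g05 _ (by decide))
  have g26 : pull H f {2, 6, 8} := pull_of_trans g26' (by decide)
  have h04 : pull H f {0, 4, 7} := pull_of_trans h04' (by decide)
  have h45 : pull H f {4, 5, 7} := pull_of_trans h45' (by decide)
  have g15 : pull H f {1, 5, 8} := by
    rcases h.coversPairs.pull f 1 8 (by decide) with ⟨k, k1, k8, hk⟩ | ⟨d, hd, hk⟩
    · fin_cases k <;> first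
        | exact absurd rfl k1
        | exact absurd rfl k8
        | exact pull_congr hk (by decide)
        | exact (hF.four C B hD hk (by decide)).elim
        | exact (hF.four hk B C h05 (by decide)).elim
        | exact (hF.four hk B h26 h05 (by decide)).elim
        | exact (hF.four hk A B h45 (by decide)).elim
        | exact (hF.four hk A B C (by decide)).elim
    · exact ((h.pathFree.pull _).four hk (pull_snoc A d hd) (pull_snoc B d hd) (pull_snoc C d hd)
        (by decide)).elim
  rcases h.triangle_avoiding_four with h1 | h1 | h1 | ⟨a, b, c, ha, hb, hc, rab, rac, rbc⟩
  · exact hF.four C B hD h1 (by decide)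
  · exact h.swap.not_five_six_of_joint (pull_trans hD _ (by decide)) (pull_trans h1 _ (by decide))
  · exact hF.four h1 h04 C g15 (by decide)
  · rcases ha with rfl | rfl <;> rcases hb with rfl | rfl <;> rcases hc with rfl | rfl <;> first
      | exact hF.four rab B C g15 (by decide)
      | exact hF.four rab B C g05 (by decide)

/-- The edge `{2,7,8}` is impossible: the triangle in the link of `7` that avoids `2` contains a pair
joining the two ends of the path, without loss of generality `0, 5`. -/
theorem not_joint (h : PathConfig H f) : ¬ pull H f {2, 7, 8} := by
  intro hD
  have hF := h.free
  rcases h.triangle_avoiding_two with h1 | h1 | ⟨h1, -⟩ | ⟨a, b, c, ha, -, hc, -, rac, -⟩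
  · exact hF.four h.right h.middle hD h1 (by decide)
  · exact hF.four h.left hD h1 h.right (by decide)
  · exact h.swap.not_five_six_of_joint (pull_trans hD _ (by decide)) (pull_trans h1 _ (by decide))
  rcases ha with rfl | rfl <;> rcases hc with rfl | rfl
  · exact h.not_zero_five_of_joint hD rac
  · exact (h.trans (Equiv.swap 5 6).toEmbedding (by decide) (by decide)
      (by decide)).not_zero_five_of_joint (pull_trans hD _ (by decide))
      (pull_trans rac _ (by decide))
  · exact (h.trans (Equiv.swap 0 1).toEmbedding (by decide) (by decide)
      (by decide)).not_zero_five_of_joint (pull_trans hD _ (by decide))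
      (pull_trans rac _ (by decide))
  · exact (h.trans (Equiv.swap 0 1 * Equiv.swap 5 6 : Equiv.Perm (Fin 9)).toEmbedding (by decide)
      (by decide) (by decide)).not_zero_five_of_joint (pull_trans hD _ (by decide))
      (pull_trans rac _ (by decide))

end PathConfig

/-- A set of triples on at least nine points that covers pairs contains a linear path of length
four if no point lies on all triangles of a link. -/
theorem not_pathFree_four [Fintype U] (hH : CoversPairs H)
    (htri : ∀ v u, u ≠ v → ∃ i j k, i ≠ u ∧ j ≠ u ∧ k ≠ u ∧
      H {v, i, j} ∧ H {v, i, k} ∧ H {v, j, k})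
    (hU : 9 ≤ Fintype.card U) : ¬ PathFree H 4 := by
  intro hN
  have : Nontrivial U := Fintype.one_lt_card_iff_nontrivial.1 (by omega)
  have htri' : ∀ v, ∃ i j k, H {v, i, j} ∧ H {v, i, k} ∧ H {v, j, k} := by
    intro v
    obtain ⟨u, hu⟩ := exists_ne v
    obtain ⟨i, j, k, -, -, -, h⟩ := htri v u hu
    exact ⟨i, j, k, h⟩
  obtain ⟨f₀, hf₀⟩ := exists_embedding_of_not_pathFree hH.card_eq (by norm_num)
    (not_pathFree_three hH htri' (by omega))
  have hA₀ : pull H f₀ {0, 1, 2} := hf₀ 0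
  have hB₀ : pull H f₀ {2, 3, 4} := hf₀ 1
  have hC₀ : pull H f₀ {4, 5, 6} := hf₀ 2
  obtain ⟨d, hd⟩ := exists_new_point f₀ (by omega)
  obtain ⟨d', hd'⟩ := exists_new_point (snoc f₀ d hd) (by omega)
  have hA₁ := pull_snoc (pull_snoc hA₀ d hd) d' hd'
  have hB₁ := pull_snoc (pull_snoc hB₀ d hd) d' hd'
  have hC₁ := pull_snoc (pull_snoc hC₀ d hd) d' hd'
  generalize snoc (snoc f₀ d hd) d' hd' = f at hA₁ hB₁ hC₁
  have hP : PathConfig H f := ⟨hH, hN, htri, pull_congr hA₁ (by decide),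
    pull_congr hB₁ (by decide), pull_congr hC₁ (by decide)⟩
  have hF := hP.free
  rcases hH.pull f 7 8 (by decide) with ⟨k, k7, k8, hk⟩ | ⟨d, hd, hk⟩
  · fin_cases k <;> first
      | exact absurd rfl k7
      | exact absurd rfl k8
      | exact hP.not_joint (pull_congr hk (by decide))
      | exact hP.not_mid (pull_congr hk (by decide))
      | exact hP.rev.not_joint (pull_trans hk _ (by decide))
      | exact hF.four hk hP.left hP.middle hP.right (by decide)
      | exact hF.four hk hP.right hP.middle hP.left (by decide)
  · exact not_outer_four hH hN _ (pull_congr (pull_snoc hP.left d hd) (by decide))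
      (pull_congr (pull_snoc hP.middle d hd) (by decide))
      (pull_congr (pull_snoc hP.right d hd) (by decide)) hk

end LinearPath

/-! ### Lagrange polynomials: optimal weightings and links -/

namespace UniformHypergraph

variable {V : Type*} [Fintype V] [DecidableEq V]

/-- The indicator of the ordered triples that span an edge. -/
def ind (G : UniformHypergraph V 3) (i j k : V) : ℝ :=
  if {i, j, k} ∈ G.edges then 1 else 0

/-- The symmetric trilinear form whose diagonal is six times the Lagrange polynomial. -/
def form (G : UniformHypergraph V 3) (x y z : V → ℝ) : ℝ :=
  ∑ i, ∑ j, ∑ k, G.ind i j k * (x i * y j * z k)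

/-- Twice the weight of the link of `v`, a sum over ordered pairs. -/
def link (G : UniformHypergraph V 3) (x : V → ℝ) (v : V) : ℝ :=
  ∑ j, ∑ k, G.ind v j k * (x j * x k)

/-- The weight of the edges through `i` and `j`, without the factors of `i` and `j`. -/
def colink (G : UniformHypergraph V 3) (x : V → ℝ) (i j : V) : ℝ :=
  ∑ k, G.ind i j k * x k

variable (G : UniformHypergraph V 3)

omit [Fintype V] in
theorem ne_of_mem_edges {i j k : V} (h : {i, j, k} ∈ G.edges) : i ≠ j ∧ i ≠ k ∧ j ≠ k := by
  have := G.uniform _ h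
  refine ⟨?_, ?_, ?_⟩ <;> rintro rfl
  · simp only [Finset.insert_eq_of_mem, Finset.mem_insert, true_or] at this
    have := Finset.card_le_two (a := i) (b := k)
    omega
  · rw [Finset.pair_comm, Finset.insert_eq_of_mem (by simp)] at this
    have := Finset.card_le_two (a := i) (b := j)
    omega
  · simp only [Finset.insert_eq_of_mem, Finset.mem_singleton] at this
    have := Finset.card_le_two (a := i) (b := j)
    omega

omit [Fintype V] in
theorem ind_nonneg (i j k : V) : 0 ≤ G.ind i j k := by
  unfold ind; split_ifs <;> norm_num

omit [Fintype V] in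
theorem ind_le_one (i j k : V) : G.ind i j k ≤ 1 := by
  unfold ind; split_ifs <;> norm_num

omit [Fintype V] in
theorem ind_comm_left (i j k : V) : G.ind i j k = G.ind j i k := by
  unfold ind; rw [Finset.insert_comm]

omit [Fintype V] in
theorem ind_comm_right (i j k : V) : G.ind i j k = G.ind i k j := by
  unfold ind; rw [Finset.pair_comm]

omit [Fintype V] in
theorem ind_eq_zero {i j k : V} (h : i = j ∨ i = k ∨ j = k) : G.ind i j k = 0 := by
  unfold ind
  rw [if_neg]
  intro hm
  have := G.ne_of_mem_edges hm
  tauto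

omit [Fintype V] in
theorem ind_ne_zero {i j k : V} : G.ind i j k ≠ 0 ↔ {i, j, k} ∈ G.edges := by
  unfold ind; split_ifs with h <;> simp [h]

/-- Each triple is counted by its six orderings. -/
theorem sum_ordered_triples (x : V → ℝ) {e : Finset V} (he : e.card = 3) :
    ∑ i, ∑ j, ∑ k, (if {i, j, k} = e then x i * x j * x k else 0) = 6 * ∏ i ∈ e, x i := by
  obtain ⟨a, b, c, hab, hac, hbc, rfl⟩ := Finset.card_eq_three.1 he
  have hf : (Finset.univ.filter fun p : V × V × V => ({p.1, p.2.1, p.2.2} : Finset V) = {a, b, c})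
      = {(a, b, c), (a, c, b), (b, a, c), (b, c, a), (c, a, b), (c, b, a)} := by
    ext ⟨i, j, k⟩
    simp only [Finset.mem_filter, Finset.mem_univ, true_and, Finset.mem_insert,
      Finset.mem_singleton, Prod.mk.injEq]
    constructor
    · intro h
      have h1 : ∀ v, (v = i ∨ v = j ∨ v = k) ↔ (v = a ∨ v = b ∨ v = c) := by
        intro v
        simpa using Finset.ext_iff.1 h v
      have ha := (h1 a).2 (by simp)
      have hb := (h1 b).2 (by simp)
      have hc := (h1 c).2 (by simp)
      grind
    · rintro (⟨rfl, rfl, rfl⟩ | ⟨rfl, rfl, rfl⟩ | ⟨rfl, rfl, rfl⟩ | ⟨rfl, rfl, rfl⟩ |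
        ⟨rfl, rfl, rfl⟩ | ⟨rfl, rfl, rfl⟩) <;> ext v <;> simp <;> tauto
  calc ∑ i, ∑ j, ∑ k, (if {i, j, k} = ({a, b, c} : Finset V) then x i * x j * x k else 0)
      = ∑ p : V × V × V, (if {p.1, p.2.1, p.2.2} = ({a, b, c} : Finset V)
          then x p.1 * x p.2.1 * x p.2.2 else 0) := by
        simp only [Fintype.sum_prod_type]
    _ = ∑ p ∈ {(a, b, c), (a, c, b), (b, a, c), (b, c, a), (c, a, b), (c, b, a)},
          x p.1 * x p.2.1 * x p.2.2 := by rw [← hf, Finset.sum_filter]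
    _ = 6 * ∏ i ∈ {a, b, c}, x i := by
        rw [Finset.prod_insert (by simp [hab, hac]), Finset.prod_pair hbc]
        rw [Finset.sum_insert (by simp [hab, hac, hbc]),
          Finset.sum_insert (by simp [hab, hac, hbc, hab.symm, hac.symm, hbc.symm]),
          Finset.sum_insert (by simp [hab, hac, hbc, hac.symm, hbc.symm]),
          Finset.sum_insert (by simp [hab, hbc, hac.symm, hbc.symm]),
          Finset.sum_pair (by simp [hab])]
        ring

theorem form_self (x : V → ℝ) : G.form x x x = 6 * G.weight x := by
  have h : ∀ i j k, G.ind i j k * (x i * x j * x k) =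
      ∑ e ∈ G.edges, (if {i, j, k} = e then x i * x j * x k else 0) := by
    intro i j k
    rw [Finset.sum_ite_eq, ind]
    split_ifs <;> simp
  unfold form
  simp only [h]
  rw [weight, Finset.mul_sum, ← Finset.sum_congr rfl
    fun e he => sum_ordered_triples x (G.uniform e he)]
  simp only [Finset.sum_comm (s := G.edges)]

theorem form_comm_left (x y z : V → ℝ) : G.form x y z = G.form y x z := by
  unfold form
  rw [Finset.sum_comm]
  refine Finset.sum_congr rfl fun i _ => Finset.sum_congr rfl fun j _ =>
    Finset.sum_congr rfl fun k _ => ?_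
  rw [G.ind_comm_left]; ring

theorem form_comm_right (x y z : V → ℝ) : G.form x y z = G.form x z y := by
  unfold form
  refine Finset.sum_congr rfl fun i _ => ?_
  rw [Finset.sum_comm]
  refine Finset.sum_congr rfl fun j _ => Finset.sum_congr rfl fun k _ => ?_
  rw [G.ind_comm_right]; ring

theorem form_add_smul (x d y z : V → ℝ) (r : ℝ) :
    G.form (fun v => x v + r * d v) y z = G.form x y z + r * G.form d y z := by
  unfold form
  simp only [Finset.mul_sum, ← Finset.sum_add_distrib]
  refine Finset.sum_congr rfl fun i _ => Finset.sum_congr rfl fun j _ =>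
    Finset.sum_congr rfl fun k _ => ?_
  ring

theorem form_expand (x d : V → ℝ) (r : ℝ) :
    G.form (fun v => x v + r * d v) (fun v => x v + r * d v) (fun v => x v + r * d v) =
      G.form x x x + 3 * r * G.form d x x + 3 * r ^ 2 * G.form d d x + r ^ 3 * G.form d d d := by
  have e1 : ∀ y z, G.form y (fun v => x v + r * d v) z = G.form y x z + r * G.form y d z := by
    intro y z
    rw [form_comm_left, form_add_smul, form_comm_left, G.form_comm_left d]
  have e2 : ∀ y z, G.form y z (fun v => x v + r * d v) = G.form y z x + r * G.form y z d := by
    intro y z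
    rw [form_comm_right, e1, form_comm_right, G.form_comm_right y d]
  have s1 : G.form x d x = G.form d x x := G.form_comm_left _ _ _
  have s2 : G.form x x d = G.form d x x := by rw [form_comm_right, form_comm_left]
  have s3 : G.form d x d = G.form d d x := G.form_comm_right _ _ _
  have s4 : G.form x d d = G.form d d x := by rw [form_comm_left, form_comm_right]
  rw [form_add_smul, e1, e1, e2, e2, e2, e2, s1, s2, s3, s4]
  ring

/-- The direction that moves weight from `i` to `j`. -/
def shift (i j : V) (v : V) : ℝ :=
  (if v = j then 1 else 0) - (if v = i then 1 else 0)

theorem sum_shift_mul (i j : V) (a : V → ℝ) : ∑ v, shift i j v * a v = a j - a i := by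
  simp [shift, sub_mul, Finset.sum_sub_distrib]

theorem form_shift (i j : V) (y z : V → ℝ) :
    G.form (shift i j) y z =
      ∑ b, ∑ c, G.ind j b c * (y b * z c) - ∑ b, ∑ c, G.ind i b c * (y b * z c) := by
  rw [← sum_shift_mul i j (fun v => ∑ b, ∑ c, G.ind v b c * (y b * z c))]
  unfold form
  refine Finset.sum_congr rfl fun v _ => ?_
  simp only [Finset.mul_sum]
  refine Finset.sum_congr rfl fun b _ => Finset.sum_congr rfl fun c _ => ?_
  ring

theorem form_shift_shift (i j : V) (z : V → ℝ) :
    G.form (shift i j) (shift i j) z = -2 * ∑ c, G.ind i j c * z c := by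
  have h : ∀ v, ∑ b, ∑ c, G.ind v b c * (shift i j b * z c) =
      ∑ c, G.ind v j c * z c - ∑ c, G.ind v i c * z c := by
    intro v
    rw [← sum_shift_mul i j (fun b => ∑ c, G.ind v b c * z c)]
    refine Finset.sum_congr rfl fun b _ => ?_
    rw [Finset.mul_sum]
    refine Finset.sum_congr rfl fun c _ => ?_
    ring
  have h1 : ∀ v, ∑ c, G.ind v v c * z c = 0 := fun v =>
    Finset.sum_eq_zero fun c _ => by rw [G.ind_eq_zero (Or.inl rfl), zero_mul]
  have h2 : ∑ c, G.ind j i c * z c = ∑ c, G.ind i j c * z c :=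
    Finset.sum_congr rfl fun c _ => by rw [G.ind_comm_left]
  rw [form_shift, h, h, h1, h1, h2]
  ring

theorem form_shift_self (i j : V) : G.form (shift i j) (shift i j) (shift i j) = 0 := by
  rw [form_shift_shift]
  have : ∑ c, G.ind i j c * shift i j c = ∑ c, shift i j c * G.ind i j c :=
    Finset.sum_congr rfl fun c _ => mul_comm _ _
  rw [this, sum_shift_mul, G.ind_eq_zero (by simp), G.ind_eq_zero (by simp)]
  simp

/-- The effect on the Lagrange polynomial of moving weight `r` from `i` to `j`. -/
theorem weight_shift (x : V → ℝ) (i j : V) (r : ℝ) :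
    6 * G.weight (fun v => x v + r * shift i j v) =
      6 * G.weight x + 3 * r * (G.link x j - G.link x i) - 6 * r ^ 2 * G.colink x i j := by
  rw [← form_self, ← form_self, form_expand, form_shift_self, form_shift_shift, form_shift]
  unfold link colink
  ring

theorem shift_mem_stdSimplex {x : V → ℝ} (hx : x ∈ stdSimplex ℝ V) (i j : V) {r : ℝ}
    (hr : 0 ≤ r) (hri : r ≤ x i) : (fun v => x v + r * shift i j v) ∈ stdSimplex ℝ V := by
  constructor
  · intro v
    have hv := hx.1 v
    dsimp only
    unfold shift
    split_ifs with h1 h2 h2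
    · simpa using hv
    · linarith
    · subst h2
      linarith
    · linarith
  · rw [Finset.sum_add_distrib, hx.2]
    have : ∑ v, r * shift i j v = r * ∑ v, shift i j v * 1 := by
      rw [Finset.mul_sum]; simp
    rw [this, sum_shift_mul]
    ring

theorem colink_nonneg {x : V → ℝ} (hx : x ∈ stdSimplex ℝ V) (i j : V) : 0 ≤ G.colink x i j :=
  Finset.sum_nonneg fun k _ => mul_nonneg (G.ind_nonneg _ _ _) (hx.1 k)

/-- At a maximum, no weight can be gained by moving weight away from a vertex. -/
theorem link_le_link {x : V → ℝ} (hx : x ∈ stdSimplex ℝ V)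
    (hmax : ∀ y ∈ stdSimplex ℝ V, G.weight y ≤ G.weight x) {i : V} (hi : 0 < x i) (j : V) :
    G.link x j ≤ G.link x i := by
  by_contra! hlt
  set a := G.link x j - G.link x i with ha
  set m := G.colink x i j with hm
  have ha0 : 0 < a := by rw [ha]; linarith
  have hm0 : 0 ≤ m := G.colink_nonneg hx i j
  set r := min (x i) (a / (2 * m + 2)) with hr
  have hr0 : 0 < r := lt_min hi (by positivity)
  have hr2 : r * (2 * m + 2) ≤ a := by
    have := min_le_right (x i) (a / (2 * m + 2))
    rwa [← hr, le_div_iff₀ (by positivity)] at this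
  have h1 := hmax _ (shift_mem_stdSimplex hx i j hr0.le (min_le_left _ _))
  have h2 := G.weight_shift x i j r
  rw [← ha, ← hm] at h2
  have h3 : r * (r * (2 * m + 2)) ≤ r * a := mul_le_mul_of_nonneg_left hr2 hr0.le
  nlinarith [mul_pos hr0 hr0]

theorem sum_mul_link (x : V → ℝ) : ∑ v, x v * G.link x v = 6 * G.weight x := by
  rw [← form_self]
  unfold form link
  simp only [Finset.mul_sum]
  refine Finset.sum_congr rfl fun i _ => Finset.sum_congr rfl fun j _ =>
    Finset.sum_congr rfl fun k _ => ?_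
  ring

theorem le_link {x : V → ℝ} (hx : x ∈ stdSimplex ℝ V)
    (hmax : ∀ y ∈ stdSimplex ℝ V, G.weight y ≤ G.weight x) {i : V} (hi : 0 < x i) :
    6 * G.weight x ≤ G.link x i := by
  rw [← sum_mul_link]
  calc ∑ v, x v * G.link x v ≤ ∑ v, x v * G.link x i :=
        Finset.sum_le_sum fun v _ =>
          mul_le_mul_of_nonneg_left (G.link_le_link hx hmax hi v) (hx.1 v)
    _ = G.link x i := by rw [← Finset.sum_mul, hx.2, one_mul]

/-- There is an optimal weighting such that any two vertices of its support lie in an edge within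
the support. A weighting of minimal support works: if the support vertices `i` and `j` are in no
such edge, the weight of `i` can be moved to `j` at no cost. -/
theorem exists_optimal_covering [Nonempty V] :
    ∃ x ∈ stdSimplex ℝ V, G.weight x = G.lagrangian ∧
      (∀ y ∈ stdSimplex ℝ V, G.weight y ≤ G.weight x) ∧
      ∀ i j, i ≠ j → x i ≠ 0 → x j ≠ 0 → ∃ k, x k ≠ 0 ∧ {i, j, k} ∈ G.edges := by
  obtain ⟨x, ⟨hx, hw, hmax⟩, hmin⟩ := exists_minimalFor_of_wellFoundedLT
    (fun x => x ∈ stdSimplex ℝ V ∧ G.weight x = G.lagrangian ∧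
      ∀ y ∈ stdSimplex ℝ V, G.weight y ≤ G.weight x)
    (fun x => (Finset.univ.filter fun v => x v ≠ 0).card) G.exists_weight_eq_lagrangian
  refine ⟨x, hx, hw, hmax, fun i j hij hi hj => ?_⟩
  by_contra! hno
  have hi0 : 0 < x i := lt_of_le_of_ne (hx.1 i) hi.symm
  have hj0 : 0 < x j := lt_of_le_of_ne (hx.1 j) hj.symm
  have hm : G.colink x i j = 0 := by
    refine Finset.sum_eq_zero fun k _ => ?_
    by_cases hk : x k = 0
    · rw [hk, mul_zero]
    · have : G.ind i j k = 0 := by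
        by_contra h
        exact hno k hk (G.ind_ne_zero.1 h)
      rw [this, zero_mul]
  have hl : G.link x j = G.link x i :=
    le_antisymm (G.link_le_link hx hmax hi0 j) (G.link_le_link hx hmax hj0 i)
  have hs := G.weight_shift x i j (x i)
  rw [hm, hl] at hs
  have hw' : G.weight (fun v => x v + x i * shift i j v) = G.weight x := by linarith
  have hlt : (Finset.univ.filter fun v => x v + x i * shift i j v ≠ 0).card <
      (Finset.univ.filter fun v => x v ≠ 0).card := by
    refine Finset.card_lt_card ⟨fun v hv => ?_, fun hsub => ?_⟩
    · simp only [Finset.mem_filter, Finset.mem_univ, true_and] at hv ⊢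
      intro h0
      have hvi : v ≠ i := fun h => hi (h ▸ h0)
      have hvj : v ≠ j := fun h => hj (h ▸ h0)
      exact hv (by simp [shift, h0, hvi, hvj])
    · have := hsub (show i ∈ _ by simpa using hi)
      refine (Finset.mem_filter.1 this).2 ?_
      simp [shift, hij]
  have := hmin ⟨shift_mem_stdSimplex hx i j hi0.le le_rfl, hw'.trans hw, fun y hy => by
    rw [hw']; exact hmax y hy⟩ hlt.le
  exact absurd hlt this.not_gt

omit [DecidableEq V] in
/-- Mantel's theorem for weighted graphs, the sum being over ordered pairs: a graph without
triangles on the support of `y` has weight at most `(∑ y) ^ 2 / 2`. -/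
theorem weighted_mantel (r : V → V → Prop) [DecidableRel r] (hr : ∀ i j, r i j → r j i)
    (y : V → ℝ) (hy : ∀ v, 0 ≤ y v)
    (htri : ∀ i j k, y i ≠ 0 → y j ≠ 0 → y k ≠ 0 → r i j → r i k → ¬ r j k) :
    ∑ i, ∑ j, (if r i j then y i * y j else 0) ≤ (∑ v, y v) ^ 2 / 2 := by
  set s := ∑ v, y v with hs
  have hs0 : 0 ≤ s := Finset.sum_nonneg fun v _ => hy v
  set m : V → ℝ := fun i => ∑ j, if r i j then y j else 0 with hm
  have hW : ∑ i, ∑ j, (if r i j then y i * y j else 0) = ∑ i, y i * m i := by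
    refine Finset.sum_congr rfl fun i _ => ?_
    rw [hm, Finset.mul_sum]
    refine Finset.sum_congr rfl fun j _ => ?_
    split_ifs <;> simp
  -- Adjacent vertices have no common neighbour, so that their degrees add up to at most `s`.
  have hadj : ∀ i j, y i ≠ 0 → y j ≠ 0 → r i j → m i + m j ≤ s := by
    intro i j hi hj hij
    rw [hm, hs, ← Finset.sum_add_distrib]
    refine Finset.sum_le_sum fun k _ => ?_
    by_cases hk : y k = 0
    · simp [hk]
    · have := htri i j k hi hj hk hij
      have := hy k
      split_ifs <;> first | tauto | linarith
  have hsum : 2 * ∑ i, y i * m i ^ 2 ≤ s * ∑ i, y i * m i := by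
    have e1 : ∑ i, y i * m i ^ 2 = ∑ i, ∑ j, (if r i j then y i * y j * m i else 0) := by
      refine Finset.sum_congr rfl fun i _ => ?_
      have : y i * m i ^ 2 = y i * m i * m i := by ring
      rw [this]
      nth_rewrite 2 [hm]
      rw [Finset.mul_sum]
      refine Finset.sum_congr rfl fun j _ => ?_
      split_ifs
      · ring
      · ring
    have e2 : ∑ i, y i * m i ^ 2 = ∑ i, ∑ j, (if r i j then y i * y j * m j else 0) := by
      rw [e1, Finset.sum_comm]
      refine Finset.sum_congr rfl fun i _ => Finset.sum_congr rfl fun j _ => ?_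
      have : r j i ↔ r i j := ⟨hr _ _, hr _ _⟩
      simp only [this]
      split_ifs
      · ring
      · rfl
    rw [two_mul]
    nth_rewrite 1 [e1]
    rw [e2, ← hW, Finset.mul_sum, ← Finset.sum_add_distrib]
    refine Finset.sum_le_sum fun i _ => ?_
    rw [Finset.mul_sum, ← Finset.sum_add_distrib]
    refine Finset.sum_le_sum fun j _ => ?_
    split_ifs with h
    · by_cases hi : y i = 0
      · simp [hi]
      by_cases hj : y j = 0
      · simp [hj]
      nlinarith [hadj i j hi hj h, mul_nonneg (hy i) (hy j)]
    · simp
  have hsq : 0 ≤ ∑ i, y i * (m i - s / 2) ^ 2 :=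
    Finset.sum_nonneg fun i _ => mul_nonneg (hy i) (sq_nonneg _)
  have hexp : ∑ i, y i * (m i - s / 2) ^ 2 =
      ∑ i, y i * m i ^ 2 - s * ∑ i, y i * m i + s ^ 2 / 4 * ∑ i, y i := by
    rw [Finset.mul_sum, Finset.mul_sum, ← Finset.sum_sub_distrib, ← Finset.sum_add_distrib]
    refine Finset.sum_congr rfl fun i _ => ?_
    ring
  rw [← hs] at hexp
  rw [hW]
  rcases hs0.eq_or_lt with h0 | h0
  · have : ∀ i, y i = 0 := fun i =>
      (Finset.sum_eq_zero_iff_of_nonneg (fun v _ => hy v)).1 (hs.symm.trans h0.symm) i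
        (Finset.mem_univ i)
    simp [this, ← h0]
  · have : s * ∑ i, y i * m i ≤ s * (s ^ 2 / 2) := by nlinarith
    exact le_of_mul_le_mul_left this h0

/-- The weighting `x` with the weight of `u` removed. -/
def drop (x : V → ℝ) (u : V) : V → ℝ := Function.update x u 0

theorem sum_drop {x : V → ℝ} (hx : x ∈ stdSimplex ℝ V) (u : V) : ∑ v, drop x u v = 1 - x u := by
  have h := Finset.sum_update_of_mem (Finset.mem_univ u) x (0 : ℝ)
  have h2 := Finset.add_sum_erase Finset.univ x (Finset.mem_univ u)
  rw [hx.2, Finset.erase_eq] at h2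
  unfold drop
  rw [h]
  linarith

theorem drop_nonneg {x : V → ℝ} (hx : x ∈ stdSimplex ℝ V) (u v : V) : 0 ≤ drop x u v := by
  unfold drop
  by_cases h : v = u
  · simp [h]
  · simpa [h] using hx.1 v

theorem link_le_sq {x : V → ℝ} (hx : x ∈ stdSimplex ℝ V) (v : V) :
    G.link x v ≤ (1 - x v) ^ 2 := by
  rw [← sum_drop hx v, sq, Finset.sum_mul_sum]
  refine Finset.sum_le_sum fun j _ => Finset.sum_le_sum fun k _ => ?_
  by_cases hj : j = v
  · rw [G.ind_eq_zero (Or.inl hj.symm), zero_mul]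
    exact mul_nonneg (drop_nonneg hx _ _) (drop_nonneg hx _ _)
  by_cases hk : k = v
  · rw [G.ind_eq_zero (Or.inr (Or.inl hk.symm)), zero_mul]
    exact mul_nonneg (drop_nonneg hx _ _) (drop_nonneg hx _ _)
  have h1 : drop x v j = x j := Function.update_of_ne hj _ _
  have h2 : drop x v k = x k := Function.update_of_ne hk _ _
  rw [h1, h2]
  exact mul_le_of_le_one_left (mul_nonneg (hx.1 j) (hx.1 k)) (G.ind_le_one _ _ _)

theorem link_sum_le {y : V → ℝ} (hy : ∀ v, 0 ≤ y v) (v : V)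
    (htri : ∀ i j k, y i ≠ 0 → y j ≠ 0 → y k ≠ 0 → {v, i, j} ∈ G.edges → {v, i, k} ∈ G.edges →
      {v, j, k} ∉ G.edges) :
    ∑ j, ∑ k, G.ind v j k * (y j * y k) ≤ (∑ u, y u) ^ 2 / 2 := by
  refine le_trans (le_of_eq ?_) (weighted_mantel (fun i j => {v, i, j} ∈ G.edges)
    (fun i j h => by rwa [Finset.pair_comm]) y hy htri)
  refine Finset.sum_congr rfl fun j _ => Finset.sum_congr rfl fun k _ => ?_
  unfold ind
  split_ifs <;> simp

/-- A link of large weight contains a triangle. -/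
theorem exists_link_triangle {x : V → ℝ} (hx : x ∈ stdSimplex ℝ V) {v : V}
    (h : 1 / 2 < G.link x v) : ∃ i j k, x i ≠ 0 ∧ x j ≠ 0 ∧ x k ≠ 0 ∧
      {v, i, j} ∈ G.edges ∧ {v, i, k} ∈ G.edges ∧ {v, j, k} ∈ G.edges := by
  by_contra! hno
  have := G.link_sum_le hx.1 v hno
  rw [hx.2] at this
  unfold link at h
  norm_num at this h
  linarith

/-- If the vertex `u` has small weight, a link of large weight contains a triangle avoiding
`u`. -/
theorem exists_link_triangle_avoiding {x : V → ℝ} (hx : x ∈ stdSimplex ℝ V) {u v : V}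
    (hu : x u ≤ 1 / 5) (h : 16 / 25 < G.link x v) : ∃ i j k, i ≠ u ∧ j ≠ u ∧ k ≠ u ∧
      x i ≠ 0 ∧ x j ≠ 0 ∧ x k ≠ 0 ∧
      {v, i, j} ∈ G.edges ∧ {v, i, k} ∈ G.edges ∧ {v, j, k} ∈ G.edges := by
  by_contra! hno
  have hdrop : ∀ w, drop x u w ≠ 0 → w ≠ u ∧ x w ≠ 0 := by
    intro w hw
    have hwu : w ≠ u := by
      rintro rfl
      exact hw (by simp [drop])
    exact ⟨hwu, by rwa [drop, Function.update_of_ne hwu] at hw⟩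
  have h1 := G.link_sum_le (drop_nonneg hx u) v fun i j k hi hj hk =>
    hno i j k (hdrop i hi).1 (hdrop j hj).1 (hdrop k hk).1 (hdrop i hi).2 (hdrop j hj).2
      (hdrop k hk).2
  have h2 : G.link x v ≤ ∑ j, ∑ k, (G.ind v j k * (drop x u j * drop x u k) +
      ((if j = u then x u * drop x u k else 0) + if k = u then drop x u j * x u else 0)) := by
    refine Finset.sum_le_sum fun j _ => Finset.sum_le_sum fun k _ => ?_
    have hju := drop_nonneg hx u j
    have hku := drop_nonneg hx u k
    have hu0 := hx.1 u
    have hi0 := G.ind_nonneg v j k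
    have hi1 := G.ind_le_one v j k
    by_cases hj : j = u
    · by_cases hk : k = u
      · rw [G.ind_eq_zero (Or.inr (Or.inr (hj.trans hk.symm)))]
        simp only [hj, hk, if_true, zero_mul]
        have := drop_nonneg hx u u
        positivity
      · have e : drop x u k = x k := Function.update_of_ne hk _ _
        have e' : drop x u j = 0 := by rw [hj]; simp [drop]
        rw [if_pos hj, if_neg hk, e', e, hj]
        have := mul_le_of_le_one_left (mul_nonneg hu0 (hx.1 k)) (hj ▸ hi1)
        linarith
    · have e : drop x u j = x j := Function.update_of_ne hj _ _
      by_cases hk : k = u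
      · have e' : drop x u k = 0 := by rw [hk]; simp [drop]
        rw [if_neg hj, if_pos hk, e', e, hk]
        have := mul_le_of_le_one_left (mul_nonneg (hx.1 j) hu0) (hk ▸ hi1)
        linarith
      · have e' : drop x u k = x k := Function.update_of_ne hk _ _
        rw [if_neg hj, if_neg hk, e, e']
        linarith
  have h3 : ∑ j, ∑ k, ((if j = u then x u * drop x u k else 0) +
      if k = u then drop x u j * x u else 0) = 2 * (x u * (1 - x u)) := by
    simp only [Finset.sum_add_distrib, Finset.sum_ite_eq', Finset.mem_univ, if_true]
    rw [Finset.sum_comm]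
    simp only [Finset.sum_ite_eq', Finset.mem_univ, if_true]
    rw [← Finset.mul_sum, ← Finset.sum_mul, sum_drop hx]
    ring
  simp only [Finset.sum_add_distrib] at h2 h3
  rw [sum_drop hx] at h1
  nlinarith [hx.1 u]

/-! ### Weightings with small support -/

theorem ind_complete (i j k : V) : (complete V 3).ind i j k =
    1 - (if i = j then 1 else 0) - (if i = k then 1 else 0) - (if j = k then 1 else 0) +
      2 * (if i = j then if j = k then 1 else 0 else 0) := by
  by_cases hij : i = j
  · rw [(complete V 3).ind_eq_zero (Or.inl hij)]
    subst hij
    by_cases hik : i = k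
    · simp [hik]; norm_num
    · simp [hik]
  by_cases hik : i = k
  · rw [(complete V 3).ind_eq_zero (Or.inr (Or.inl hik))]
    subst hik
    simp [hij, Ne.symm hij]
  by_cases hjk : j = k
  · rw [(complete V 3).ind_eq_zero (Or.inr (Or.inr hjk))]
    simp [hjk, hik]
  · rw [ind, if_pos (by simp [complete, Finset.card_insert_of_notMem, hij, hik, hjk])]
    simp [hij, hik, hjk]

/-- The third elementary symmetric polynomial in terms of power sums, on the simplex. -/
theorem weight_complete {x : V → ℝ} (hx : x ∈ stdSimplex ℝ V) :
    6 * (complete V 3).weight x = 1 + ∑ v, (2 * x v ^ 3 - 3 * x v ^ 2) := by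
  rw [← form_self]
  have h : ∀ i j k : V, (complete V 3).ind i j k * (x i * x j * x k) =
      x i * x j * x k - (if i = j then x i * x j * x k else 0) -
      (if i = k then x i * x j * x k else 0) - (if j = k then x i * x j * x k else 0) +
      2 * (if i = j then if j = k then x i * x j * x k else 0 else 0) := by
    intro i j k
    rw [ind_complete]
    split_ifs <;> ring
  have h1 : ∑ i, ∑ j, ∑ k, x i * x j * x k = 1 := by
    simp only [← Finset.mul_sum, hx.2, mul_one]
  have h2 : ∑ i, ∑ j, ∑ k, (if i = j then x i * x j * x k else 0) = ∑ v, x v ^ 2 := by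
    refine Finset.sum_congr rfl fun i _ => ?_
    rw [Finset.sum_comm]
    simp only [Finset.sum_ite_eq, Finset.mem_univ, if_true, ← Finset.mul_sum, hx.2]
    ring
  have h3 : ∑ i, ∑ j, ∑ k, (if i = k then x i * x j * x k else 0) = ∑ v, x v ^ 2 := by
    refine Finset.sum_congr rfl fun i _ => ?_
    simp only [Finset.sum_ite_eq, Finset.mem_univ, if_true, ← Finset.mul_sum, ← Finset.sum_mul,
      hx.2]
    ring
  have h4 : ∑ i, ∑ j, ∑ k, (if j = k then x i * x j * x k else 0) = ∑ v, x v ^ 2 := by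
    rw [Finset.sum_comm]
    refine Finset.sum_congr rfl fun j _ => ?_
    simp only [Finset.sum_ite_eq, Finset.mem_univ, if_true, ← Finset.sum_mul, hx.2]
    ring
  have h5 : ∑ i, ∑ j, ∑ k, (if i = j then if j = k then x i * x j * x k else 0 else 0) =
      ∑ v, x v ^ 3 := by
    refine Finset.sum_congr rfl fun i _ => ?_
    rw [Finset.sum_comm]
    simp only [Finset.sum_ite_eq, Finset.mem_univ, if_true]
    ring
  have h5' : ∑ i, ∑ j, ∑ k, 2 * (if i = j then if j = k then x i * x j * x k else 0 else 0) =
      2 * ∑ v, x v ^ 3 := by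
    rw [← h5]
    simp only [Finset.mul_sum]
  have h6 : ∑ v, (2 * x v ^ 3 - 3 * x v ^ 2) = 2 * ∑ v, x v ^ 3 - 3 * ∑ v, x v ^ 2 := by
    rw [Finset.sum_sub_distrib, Finset.mul_sum, Finset.mul_sum]
  rw [h6]
  unfold form
  simp only [h, Finset.sum_add_distrib, Finset.sum_sub_distrib]
  rw [h1, h2, h3, h4, h5']
  ring

/-- The uniform weighting. -/
theorem le_lagrangian_complete (n : ℕ) [NeZero n] :
    (n.choose 3 : ℝ) / n ^ 3 ≤ (complete (Fin n) 3).lagrangian := by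
  obtain ⟨x, -, hx, hmax⟩ := (complete (Fin n) 3).exists_weight_eq_lagrangian
  have hn : (n : ℝ) ≠ 0 := Nat.cast_ne_zero.2 (NeZero.ne n)
  have h := hmax (fun _ => 1 / (n : ℝ)) ⟨fun _ => by positivity, by simp [hn]⟩
  rw [hx] at h
  refine le_trans (le_of_eq ?_) h
  rw [weight, Finset.sum_congr rfl fun e he => by
    rw [Finset.prod_const, (complete (Fin n) 3).uniform e he]]
  simp [complete, div_eq_mul_inv]

omit [DecidableEq V] in
theorem weight_le_complete (G : UniformHypergraph V 3) {x : V → ℝ} (hx : x ∈ stdSimplex ℝ V) :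
    G.weight x ≤ (complete V 3).weight x :=
  Finset.sum_le_sum_of_subset_of_nonneg
    (fun e he => Finset.mem_powersetCard.2 ⟨Finset.subset_univ e, G.uniform e he⟩)
    fun _ _ _ => Finset.prod_nonneg fun i _ => hx.1 i

/-- A triple that is not an edge is missing from the Lagrange polynomial. -/
theorem weight_add_le_complete (G : UniformHypergraph V 3) {x : V → ℝ} (hx : x ∈ stdSimplex ℝ V)
    {e : Finset V} (he : e.card = 3) (heG : e ∉ G.edges) :
    G.weight x + ∏ i ∈ e, x i ≤ (complete V 3).weight x := by
  rw [add_comm]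
  unfold weight
  rw [← Finset.sum_insert (f := fun e => ∏ i ∈ e, x i) heG]
  refine Finset.sum_le_sum_of_subset_of_nonneg (fun s hs => ?_)
    fun _ _ _ => Finset.prod_nonneg fun i _ => hx.1 i
  rcases Finset.mem_insert.1 hs with rfl | hs
  · exact Finset.mem_powersetCard.2 ⟨Finset.subset_univ s, he⟩
  · exact Finset.mem_powersetCard.2 ⟨Finset.subset_univ s, G.uniform s hs⟩

/-- The tangent line of `2 x ^ 3 - 3 x ^ 2` at `c`, summed over the support of `x`. -/
theorem weight_complete_eq {x : V → ℝ} (hx : x ∈ stdSimplex ℝ V) (c : ℝ) :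
    6 * (complete V 3).weight x = 1 - 6 * c + 6 * c ^ 2 +
      (Finset.univ.filter fun v => x v ≠ 0).card * (3 * c ^ 2 - 4 * c ^ 3) -
      ∑ v with x v ≠ 0, (x v - c) ^ 2 * (3 - 4 * c - 2 * x v) := by
  have hs : ∑ v, (2 * x v ^ 3 - 3 * x v ^ 2) = ∑ v with x v ≠ 0, (2 * x v ^ 3 - 3 * x v ^ 2) := by
    rw [Finset.sum_filter_of_ne]
    intro v _ hv h0
    exact hv (by rw [h0]; ring)
  have h1 : ∑ v with x v ≠ 0, x v = 1 := by
    rw [Finset.sum_filter_of_ne fun v _ h => h, hx.2]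
  have h2 : ∑ v with x v ≠ 0, (2 * x v ^ 3 - 3 * x v ^ 2) =
      (Finset.univ.filter fun v => x v ≠ 0).card * (3 * c ^ 2 - 4 * c ^ 3) +
        (6 * c ^ 2 - 6 * c) * (∑ v with x v ≠ 0, x v) -
        ∑ v with x v ≠ 0, (x v - c) ^ 2 * (3 - 4 * c - 2 * x v) := by
    rw [← nsmul_eq_mul, ← Finset.sum_const, Finset.mul_sum, ← Finset.sum_add_distrib,
      ← Finset.sum_sub_distrib]
    refine Finset.sum_congr rfl fun v _ => ?_
    ring
  rw [weight_complete hx, hs, h2, h1]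
  ring

omit [DecidableEq V] in
theorem le_one_of_mem_stdSimplex {x : V → ℝ} (hx : x ∈ stdSimplex ℝ V) (v : V) : x v ≤ 1 := by
  rw [← hx.2]
  exact Finset.single_le_sum (fun i _ => hx.1 i) (Finset.mem_univ v)

/-- A weighting supported on at most `m = 1 / c` vertices. -/
theorem weight_le_of_card_support_le (G : UniformHypergraph V 3) {x : V → ℝ}
    (hx : x ∈ stdSimplex ℝ V) {m : ℕ} {c : ℝ} (hc0 : 0 < c) (hc : c ≤ 1 / 6) (hmc : m * c = 1)
    (hm : (Finset.univ.filter fun v => x v ≠ 0).card ≤ m) :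
    6 * G.weight x ≤ 1 - 3 * c + 2 * c ^ 2 := by
  have h1 := G.weight_le_complete hx
  have h2 := weight_complete_eq hx c
  have h3 : 0 ≤ ∑ v with x v ≠ 0, (x v - c) ^ 2 * (3 - 4 * c - 2 * x v) :=
    Finset.sum_nonneg fun v _ => mul_nonneg (sq_nonneg _) (by
      have := le_one_of_mem_stdSimplex hx v
      linarith)
  have h4 : ((Finset.univ.filter fun v => x v ≠ 0).card : ℝ) * (3 * c ^ 2 - 4 * c ^ 3) ≤
      m * (3 * c ^ 2 - 4 * c ^ 3) := by
    refine mul_le_mul_of_nonneg_right (by exact_mod_cast hm) ?_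
    nlinarith [pow_pos hc0 2]
  have h5 : m * (3 * c ^ 2 - 4 * c ^ 3) = 3 * c - 4 * c ^ 2 := by
    have : m * (3 * c ^ 2 - 4 * c ^ 3) = m * c * (3 * c - 4 * c ^ 2) := by ring
    rw [this, hmc, one_mul]
  linarith

/-- If the support has fewer than `m = 1 / c` vertices, or some triple of support vertices is not
an edge, then the bound of `weight_le_of_card_support_le` is missed by a fixed amount. -/
theorem weight_le_sub_of_card_support_le (G : UniformHypergraph V 3) {x : V → ℝ}
    (hx : x ∈ stdSimplex ℝ V) {m : ℕ} {c : ℝ} (hc0 : 0 < c) (hc : c ≤ 1 / 6) (hmc : m * c = 1)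
    (hm : (Finset.univ.filter fun v => x v ≠ 0).card ≤ m)
    (hG : (Finset.univ.filter fun v => x v ≠ 0).card < m ∨
      ∃ e : Finset V, e.card = 3 ∧ (∀ v ∈ e, x v ≠ 0) ∧ e ∉ G.edges) :
    6 * G.weight x ≤ 1 - 3 * c + 2 * c ^ 2 - c ^ 3 / 2 := by
  have h1 := G.weight_le_complete hx
  have h2 := weight_complete_eq hx c
  have h3' : ∀ v, 0 ≤ (x v - c) ^ 2 * (3 - 4 * c - 2 * x v) := fun v =>
    mul_nonneg (sq_nonneg _) (by
      have := le_one_of_mem_stdSimplex hx v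
      linarith)
  have h3 : 0 ≤ ∑ v with x v ≠ 0, (x v - c) ^ 2 * (3 - 4 * c - 2 * x v) :=
    Finset.sum_nonneg fun v _ => h3' v
  have hc2 := pow_pos hc0 2
  have hc3 := pow_pos hc0 3
  have hcc : c ^ 3 ≤ c ^ 2 / 6 := by nlinarith
  have hslope : 0 ≤ 3 * c ^ 2 - 4 * c ^ 3 := by linarith
  have h5 : m * (3 * c ^ 2 - 4 * c ^ 3) = 3 * c - 4 * c ^ 2 := by
    have : m * (3 * c ^ 2 - 4 * c ^ 3) = m * c * (3 * c - 4 * c ^ 2) := by ring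
    rw [this, hmc, one_mul]
  rcases hG with hlt | ⟨e, he, hesupp, heG⟩
  · have h4 : ((Finset.univ.filter fun v => x v ≠ 0).card + 1 : ℝ) * (3 * c ^ 2 - 4 * c ^ 3) ≤
        m * (3 * c ^ 2 - 4 * c ^ 3) :=
      mul_le_mul_of_nonneg_right (by exact_mod_cast hlt) hslope
    linarith
  · have h4 : ((Finset.univ.filter fun v => x v ≠ 0).card : ℝ) * (3 * c ^ 2 - 4 * c ^ 3) ≤
        m * (3 * c ^ 2 - 4 * c ^ 3) :=
      mul_le_mul_of_nonneg_right (by exact_mod_cast hm) hslope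
    by_cases hsmall : ∃ v ∈ e, x v ≤ c / 2
    -- A vertex of small weight makes the term of `v` in the deficit large.
    · obtain ⟨v, hv, hvc⟩ := hsmall
      have h6 : (x v - c) ^ 2 * (3 - 4 * c - 2 * x v) ≤
          ∑ v with x v ≠ 0, (x v - c) ^ 2 * (3 - 4 * c - 2 * x v) :=
        Finset.single_le_sum (f := fun v => (x v - c) ^ 2 * (3 - 4 * c - 2 * x v))
          (fun v _ => h3' v) (by simpa using hesupp v hv)
      have h7 : c ^ 2 / 4 ≤ (x v - c) ^ 2 := by nlinarith
      have h8 : c ^ 2 / 4 * 1 ≤ (x v - c) ^ 2 * (3 - 4 * c - 2 * x v) :=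
        mul_le_mul h7 (by linarith) zero_le_one (sq_nonneg _)
      linarith
    -- Otherwise the missing triple has large weight.
    · push Not at hsmall
      have h6 := G.weight_add_le_complete hx he heG
      have h7 : ∏ _i ∈ e, c / 2 ≤ ∏ i ∈ e, x i :=
        Finset.prod_le_prod (fun _ _ => by positivity) fun i hi => (hsmall i hi).le
      rw [Finset.prod_const, he] at h7
      have h8 : (c / 2) ^ 3 = c ^ 3 / 8 := by ring
      linarith

/-! ### The bounds for `P_3` and `P_4` -/

/-- The edges of `G` on the support of `x`. -/
def supportEdges (G : UniformHypergraph V 3) (x : V → ℝ) (e : Finset {v // x v ≠ 0}) : Prop :=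
  e.map (Function.Embedding.subtype _) ∈ G.edges

omit [Fintype V] in
theorem supportEdges_triple (G : UniformHypergraph V 3) (x : V → ℝ) (i j k : {v // x v ≠ 0}) :
    G.supportEdges x {i, j, k} ↔ {i.1, j.1, k.1} ∈ G.edges := by
  simp [supportEdges, Finset.map_insert]

omit [Fintype V] in
theorem contains_linearPath (G : UniformHypergraph V 3) {x : V → ℝ} {t : ℕ} (ht : 0 < t)
    (h : ¬ LinearPath.PathFree (G.supportEdges x) t) : G.Contains (linearPath t) := by
  obtain ⟨f, hf⟩ := LinearPath.exists_embedding_of_not_pathFree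
    (fun e he => by rw [← G.uniform _ he, Finset.card_map]) ht h
  refine ⟨f.trans (Function.Embedding.subtype _), fun e he => ?_⟩
  obtain ⟨i, -, rfl⟩ := Finset.mem_image.1 he
  have := hf i
  rwa [supportEdges, Finset.map_map] at this

/-- An optimal weighting of a `P_t`-free `3`-graph with more than `2t` support vertices has small
weight, for otherwise its support would contain a linear path of length `t`. -/
theorem weight_le_of_card_support_gt (G : UniformHypergraph V 3) {x : V → ℝ}
    (hx : x ∈ stdSimplex ℝ V) (hmax : ∀ y ∈ stdSimplex ℝ V, G.weight y ≤ G.weight x)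
    (hcov : ∀ i j, i ≠ j → x i ≠ 0 → x j ≠ 0 → ∃ k, x k ≠ 0 ∧ {i, j, k} ∈ G.edges)
    {t : ℕ} (ht : t = 3 ∨ t = 4) (hG : G.Free (linearPath t))
    (hS : 2 * t < (Finset.univ.filter fun v => x v ≠ 0).card) :
    6 * G.weight x ≤ if t = 3 then 1 / 2 else 16 / 25 := by
  by_contra! hlt
  have hpos : ∀ v, x v ≠ 0 → 0 < x v := fun v hv => lt_of_le_of_ne (hx.1 v) hv.symm
  have hC : LinearPath.CoversPairs (G.supportEdges x) := by
    refine ⟨fun e he => by rw [← G.uniform _ he, Finset.card_map], fun i j hij => ?_⟩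
    obtain ⟨k, hk, h⟩ := hcov i j (fun h => hij (Subtype.ext h)) i.2 j.2
    exact ⟨⟨k, hk⟩, (G.supportEdges_triple x i j ⟨k, hk⟩).2 h⟩
  rw [← Fintype.card_subtype] at hS
  refine hG (G.contains_linearPath (x := x) (by omega) ?_)
  rcases ht with rfl | rfl
  · rw [if_pos rfl] at hlt
    refine LinearPath.not_pathFree_three hC (fun v => ?_) hS
    obtain ⟨i, j, k, hi, hj, hk, hij, hik, hjk⟩ :=
      G.exists_link_triangle hx (hlt.trans_le (G.le_link hx hmax (hpos v v.2)))
    exact ⟨⟨i, hi⟩, ⟨j, hj⟩, ⟨k, hk⟩, (G.supportEdges_triple x v ⟨i, hi⟩ ⟨j, hj⟩).2 hij,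
      (G.supportEdges_triple x v ⟨i, hi⟩ ⟨k, hk⟩).2 hik,
      (G.supportEdges_triple x v ⟨j, hj⟩ ⟨k, hk⟩).2 hjk⟩
  · rw [if_neg (by norm_num)] at hlt
    refine LinearPath.not_pathFree_four hC (fun v u _ => ?_) hS
    -- The link of `u` has weight more than `16 / 25`, at most `(1 - x u) ^ 2`.
    have hu : x u ≤ 1 / 5 := by
      have h1 := hlt.trans_le ((G.le_link hx hmax (hpos u u.2)).trans (G.link_le_sq hx u))
      have h2 := le_one_of_mem_stdSimplex hx u.1
      nlinarith
    obtain ⟨i, j, k, hiu, hju, hku, hi, hj, hk, hij, hik, hjk⟩ :=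
      G.exists_link_triangle_avoiding hx hu (hlt.trans_le (G.le_link hx hmax (hpos v v.2)))
    exact ⟨⟨i, hi⟩, ⟨j, hj⟩, ⟨k, hk⟩, fun h => hiu (congrArg Subtype.val h),
      fun h => hju (congrArg Subtype.val h), fun h => hku (congrArg Subtype.val h),
      (G.supportEdges_triple x v ⟨i, hi⟩ ⟨j, hj⟩).2 hij,
      (G.supportEdges_triple x v ⟨i, hi⟩ ⟨k, hk⟩).2 hik,
      (G.supportEdges_triple x v ⟨j, hj⟩ ⟨k, hk⟩).2 hjk⟩

omit [Fintype V] [DecidableEq V] in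
theorem exists_missing_triple {G : UniformHypergraph V 3} {n : ℕ}
    (hG : G.Free (complete (Fin n) 3)) {S : Finset V} (hS : S.card = n) :
    ∃ e : Finset V, e.card = 3 ∧ (∀ v ∈ e, v ∈ S) ∧ e ∉ G.edges := by
  by_contra! hno
  refine hG ⟨(S.equivFinOfCardEq hS).symm.toEmbedding.trans (Function.Embedding.subtype _),
    fun e he => hno _ ?_ fun v hv => ?_⟩
  · rw [Finset.card_map]
    exact (Finset.mem_powersetCard.1 he).2
  · obtain ⟨i, -, rfl⟩ := Finset.mem_map.1 hv
    exact ((S.equivFinOfCardEq hS).symm i).2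

/-- The value of `6 λ` at the uniform weighting, `c` being the weight of each vertex. -/
theorem lagrangian_complete_ge {t : ℕ} (ht : t = 3 ∨ t = 4) {c : ℝ} (hc : c = 1 / (2 * t)) :
    1 - 3 * c + 2 * c ^ 2 ≤ 6 * (complete (Fin (2 * t)) 3).lagrangian := by
  rcases ht with rfl | rfl
  · have := le_lagrangian_complete 6
    norm_num [Nat.choose] at this hc
    subst hc
    norm_num
    linarith
  · have := le_lagrangian_complete 8
    norm_num [Nat.choose] at this hc
    subst hc
    norm_num
    linarith

omit [DecidableEq V] in
/-- The two upper bounds for the Lagrangian of a `P_t`-free `3`-graph, in terms of `c = 1 / (2t)`. -/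
theorem lagrangian_bounds {t : ℕ} (ht : t = 3 ∨ t = 4) {c : ℝ} (hc : c = 1 / (2 * t))
    (G : UniformHypergraph V 3) (hG : G.Free (linearPath t)) :
    6 * G.lagrangian ≤ 1 - 3 * c + 2 * c ^ 2 ∧ (G.Free (complete (Fin (2 * t)) 3) →
      6 * G.lagrangian ≤ 1 - 3 * c + 2 * c ^ 2 - c ^ 3 / 2) := by
  classical
  have hc0 : 0 < c := by rcases ht with rfl | rfl <;> norm_num at hc <;> subst hc <;> norm_num
  have hc6 : c ≤ 1 / 6 := by rcases ht with rfl | rfl <;> norm_num at hc <;> subst hc <;> norm_num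
  have hc3 := pow_pos hc0 3
  have hmc : (2 * t : ℕ) * c = 1 := by
    rcases ht with rfl | rfl <;> norm_num at hc <;> subst hc <;> norm_num
  rcases isEmpty_or_nonempty V with hV | hV
  · have h0 : G.lagrangian = 0 := by
      unfold lagrangian
      have : stdSimplex ℝ V = ∅ := by
        ext x
        simp [stdSimplex]
      rw [this, Set.image_empty, Real.sSup_empty]
    rw [h0]
    constructor
    · nlinarith
    · intro
      nlinarith
  obtain ⟨x, hx, hw, hmax, hcov⟩ := G.exists_optimal_covering
  rw [← hw]
  by_cases hS : (Finset.univ.filter fun v => x v ≠ 0).card ≤ 2 * t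
  · refine ⟨G.weight_le_of_card_support_le hx hc0 hc6 hmc hS, fun hK =>
      G.weight_le_sub_of_card_support_le hx hc0 hc6 hmc hS ?_⟩
    rcases hS.lt_or_eq with h | h
    · exact Or.inl h
    · obtain ⟨e, he, heS, heG⟩ := exists_missing_triple hK h
      exact Or.inr ⟨e, he, fun v hv => by simpa using heS v hv, heG⟩
  · have h := G.weight_le_of_card_support_gt hx hmax hcov ht hG (not_le.1 hS)
    have h' : 6 * G.weight x ≤ 1 - 3 * c + 2 * c ^ 2 - c ^ 3 / 2 := by
      refine h.trans ?_
      rcases ht with rfl | rfl <;> norm_num at hc <;> subst hc <;> norm_num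
    exact ⟨by linarith, fun _ => h'⟩

omit [Fintype V] [DecidableEq V] in
theorem lagrangianDensity_linearPath {t : ℕ} (ht : t = 3 ∨ t = 4) :
    (linearPath t).lagrangianDensity = (3 ! : ℝ) * (complete (Fin (2 * t)) 3).lagrangian := by
  have h6 : ((3 ! : ℕ) : ℝ) = 6 := by norm_num [Nat.factorial]
  have hfree : (complete (Fin (2 * t)) 3).Free (linearPath t) := by
    rintro ⟨f, -⟩
    have := Fintype.card_le_of_embedding f
    simp at this
  have hmem : (3 ! : ℝ) * (complete (Fin (2 * t)) 3).lagrangian ∈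
      {a : ℝ | ∃ (V : Type) (_ : Fintype V) (G : UniformHypergraph V 3),
        G.Free (linearPath t) ∧ a = (3 ! : ℝ) * G.lagrangian} :=
    ⟨Fin (2 * t), inferInstance, complete (Fin (2 * t)) 3, hfree, rfl⟩
  refine le_antisymm (csSup_le ⟨_, hmem⟩ ?_) (le_csSup (bddAbove_lagrangianDensity _) hmem)
  rintro a ⟨V, _, G, hG, rfl⟩
  rw [h6]
  exact (lagrangian_bounds ht rfl G hG).1.trans (lagrangian_complete_ge ht rfl)

end UniformHypergraph

theorem theorem3p1 (t : ℕ) (ht : t = 3 ∨ t = 4) :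
    (UniformHypergraph.linearPath t).lagrangianDensity =
        (3 ! : ℝ) * (UniformHypergraph.complete (Fin (2 * t)) 3).lagrangian ∧
    (UniformHypergraph.linearPath t).IsPerfect ∧
    ∃ ε : ℝ, 0 < ε ∧ ∀ (V : Type*) [Fintype V] (G : UniformHypergraph V 3),
      G.Free (UniformHypergraph.linearPath t) →
      G.Free (UniformHypergraph.complete (Fin (2 * t)) 3) →
      G.lagrangian ≤ (UniformHypergraph.complete (Fin (2 * t)) 3).lagrangian - ε := by
  have hdens := UniformHypergraph.lagrangianDensity_linearPath ht
  refine ⟨hdens, ?_, (1 / (2 * t : ℝ)) ^ 3 / 12, ?_, ?_⟩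
  · rw [UniformHypergraph.IsPerfect, hdens, Fintype.card_fin]
    rfl
  · rcases ht with rfl | rfl <;> norm_num
  · intro V _ G hP hK
    have h1 := (UniformHypergraph.lagrangian_bounds ht rfl G hP).2 hK
    have h2 := UniformHypergraph.lagrangian_complete_ge ht rfl
    linarith
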